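/- Machine model: a deterministic word RAM with words of $O(\log N)$ bits, where $N$ is the size of the input (for a directed graph, its number of vertices plus its number of edges; for a coverability instance, the size $n$ defined below); the constant in the $O(\cdot)$ may depend on the algorithm. The \emph{$k$-cycle hypothesis} states: for every $\varepsilon>0$ there is an integer $k\ge 1$ such that no deterministic algorithm decides in time $O(m^{2-\varepsilon})$ whether a given directed graph with $m$ edges contains a (simple directed) cycle of length $k$. A \emph{unary $2$-VASS} $\mathcal V=(Q,T)$ consists of a finite non-empty set $Q$ of states and a finite non-empty set $T\subseteq Q\times\{-1,0,1\}^2\times Q$ of transitions; its size is $|Q|+|T|$. A configuration $q(\mathbf v)$ is a pair in $Q\times\mathbb N^2$, and there is a step from $p(\mathbf u)$ to $q(\mathbf v)$ if $(p,\mathbf v-\mathbf u,q)\in T$; counter values are not bounded from above. An instance of \emph{coverability} consists of a unary $2$-VASS $\mathcal V$ and two configurations $p(\mathbf u)$, $q(\mathbf v)$; the question is whether a finite (possibly empty) sequence of steps leads from $p(\mathbf u)$ to some $q(\mathbf v')$ with $\mathbf v'\ge\mathbf v$ componentwise. The size of the instance is $n=|Q|+|T|+\|\mathbf u\|+\|\mathbf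 v\|$, where $\|\mathbf v\|=\max\{1,|\mathbf v[1]|,|\mathbf v[2]|\}$. \textbf{Corollary.} Assume the $k$-cycle hypothesis. Then coverability in unary $2$-VASS requires $n^{2-o(1)}$ time; that is, for every $\varepsilon>0$, no deterministic algorithm decides coverability in unary $2$-VASS in time $O(n^{2-\varepsilon})$, where $n$ is the size of the instance. -/

import Mathlib

/-! ### Deterministic word RAM -/

namespace WordRAM

/-- Binary operations on words, each executed in one step. -/
inductive BinOp
  | add | sub | mul | div | mod | and | or | xor | shiftLeft | shiftRight

/-- The value of an operation on natural numbers; subtraction is truncated at `0`. -/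
def BinOp.eval : BinOp → ℕ → ℕ → ℕ
  | .add, a, b => a + b
  | .sub, a, b => a - b
  | .mul, a, b => a * b
  | .div, a, b => a / b
  | .mod, a, b => a % b
  | .and, a, b => a &&& b
  | .or, a, b => a ||| b
  | .xor, a, b => a ^^^ b
  | .shiftLeft, a, b => a <<< b
  | .shiftRight, a, b => a >>> b

/-- Instructions; `L` is the set of program labels, and registers are named by natural numbers. -/
inductive Instr (L : Type)
  /-- stop and accept (`true`) or reject (`false`) -/
  | halt (answer : Bool)
  /-- `R[dst] := v` -/
  | const (dst v : ℕ) (next : L)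
  /-- `R[dst] := R[a] op R[b]` -/
  | op (o : BinOp) (dst a b : ℕ) (next : L)
  /-- `R[dst] := M[R[addr]]` -/
  | load (dst addr : ℕ) (next : L)
  /-- `M[R[addr]] := R[src]` -/
  | store (addr src : ℕ) (next : L)
  /-- conditional jump on `R[a] < R[b]` -/
  | branchLt (a b : ℕ) (yes no : L)
  /-- conditional jump on `R[a] = R[b]` -/
  | branchEq (a b : ℕ) (yes no : L)

/-- A program: finitely many labels, an instruction at each label, and a start label. It therefore
mentions only finitely many registers. -/
structure Program where
  Label : Type
  finite : Finite Label
  start : Label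
  instr : Label → Instr Label

/-- A configuration: the current label, the registers and the memory. -/
structure Config (P : Program) where
  label : P.Label
  reg : ℕ → ℕ
  mem : ℕ → ℕ

/-- One step with words of `w` bits. Every value that is written has to be a word, that is, smaller
than `2 ^ w`; an instruction whose result does not fit is an error (there is no next configuration).
Arithmetic modulo a power of two is available through `mod`. There is no next configuration
either at a `halt`. -/
def step (P : Program) (w : ℕ) (c : Config P) : Option (Config P) :=
  match P.instr c.label with
  | .halt _ => none
  | .const dst v next =>
      if v < 2 ^ w then some ⟨next, Function.update c.reg dst v, c.mem⟩ else none
  | .op o dst a b next =>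
      if o.eval (c.reg a) (c.reg b) < 2 ^ w then
        some ⟨next, Function.update c.reg dst (o.eval (c.reg a) (c.reg b)), c.mem⟩
      else none
  | .load dst addr next =>
      some ⟨next, Function.update c.reg dst (c.mem (c.reg addr)), c.mem⟩
  | .store addr src next =>
      some ⟨next, c.reg, Function.update c.mem (c.reg addr) (c.reg src)⟩
  | .branchLt a b yes no => some ⟨if c.reg a < c.reg b then yes else no, c.reg, c.mem⟩
  | .branchEq a b yes no => some ⟨if c.reg a = c.reg b then yes else no, c.reg, c.mem⟩

/-- `HaltsIn P w c t b`: with `w`-bit words, the run of `P` from `c` executes exactly `t`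
instructions, the last one being `halt b`. -/
inductive HaltsIn (P : Program) (w : ℕ) : Config P → ℕ → Bool → Prop
  | halt {c : Config P} {b : Bool} (h : P.instr c.label = .halt b) : HaltsIn P w c 1 b
  | step {c c' : Config P} {t : ℕ} {b : Bool} (h : step P w c = some c')
      (h' : HaltsIn P w c' t b) : HaltsIn P w c (t + 1) b

/-- The initial configuration: the input occupies the memory cells `0, 1, 2, …`, and all the other
cells and all registers hold `0`. -/
def init (P : Program) (input : List ℕ) : Config P :=
  ⟨P.start, fun _ => 0, fun i => input.getD i 0⟩

/-- The decision problem `yes` on instances `I`, encoded by `enc`, can be decided deterministically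
in time `O(T)` on a word RAM with words of `O(log len)` bits: one program and two constants
`c`, `C` serve all instances. -/
def DecidableInTime {I : Type} (enc : I → List ℕ) (yes : I → Prop) (len : I → ℕ) (T : I → ℝ) :
    Prop :=
  ∃ (P : Program) (c : ℕ) (C : ℝ), ∀ x : I, ∃ (t : ℕ) (b : Bool),
    HaltsIn P (c * (Nat.log 2 (len x) + 1)) (init P (enc x)) t b ∧
      (b = true ↔ yes x) ∧ (t : ℝ) ≤ C * T x

end WordRAM

/-! ### Directed cycles of length `k` -/

/-- `G` contains a (simple, directed) cycle of length `k`, for `k` positive. -/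
def Digraph.HasCycle {V : Type*} (G : Digraph V) (k : ℕ) : Prop :=
  ∃ v : ZMod k → V, Function.Injective v ∧ ∀ i, G.Adj (v i) (v (i + 1))

/-- A finite directed graph on the vertices `0, …, n - 1`, given by a list of its edges. -/
structure DigraphInput where
  n : ℕ
  G : Digraph (Fin n)
  edges : List (Fin n × Fin n)
  nodup : edges.Nodup
  mem_edges : ∀ u v, (u, v) ∈ edges ↔ G.Adj u v

namespace DigraphInput

/-- The number of edges. -/
def m (x : DigraphInput) : ℕ := x.edges.length

/-- `n`, `m`, and then the two end points of each edge. -/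
def encode (x : DigraphInput) : List ℕ :=
  [x.n, x.m] ++ x.edges.flatMap fun e => [e.1.val, e.2.val]

end DigraphInput

/-- For every `ε > 0` there is some `k` such that no deterministic algorithm decides in time
`O(m ^ (2 - ε))` whether a directed graph with `m` edges has a cycle of length `k`.
(The bound is written with `m + 1` so that it is not `0` for a graph without edges.) -/
def KCycleHypothesis : Prop :=
  ∀ ε : ℝ, 0 < ε → ∃ k : ℕ, 1 ≤ k ∧
    ¬ WordRAM.DecidableInTime DigraphInput.encode (fun x => x.G.HasCycle k)
      (fun x => x.n + x.m) (fun x => ((x.m : ℝ) + 1) ^ (2 - ε))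

/-! ### Vector addition systems with states -/

/-- `max {1, |v 0|, …, |v (d - 1)|}`. -/
def vecNorm {d : ℕ} (v : Fin d → ℤ) : ℕ :=
  max 1 (Finset.univ.sup fun i => (v i).natAbs)

/-- A `d`-dimensional vector addition system with state set `Q`, given by its non-empty finite set
of transitions `(p, x, q)`. -/
structure VASS (d : ℕ) (Q : Type*) where
  T : Finset (Q × (Fin d → ℤ) × Q)
  nonempty : T.Nonempty

namespace VASS

variable {d : ℕ} {Q : Type*}

/-- A step between configurations `p(u)` and `q(v)`; counter values are non-negative. -/
def Step (V : VASS d Q) (c c' : Q × (Fin d → ℕ)) : Prop :=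
  ∃ x : Fin d → ℤ, (c.1, x, c'.1) ∈ V.T ∧ ∀ i, x i = (c'.2 i : ℤ) - (c.2 i : ℤ)

/-- There is a run from the first configuration to the second one. -/
def Reach (V : VASS d Q) : Q × (Fin d → ℕ) → Q × (Fin d → ℕ) → Prop :=
  Relation.ReflTransGen V.Step

/-- From the first configuration some configuration `q(v')` with `v ≤ v'` can be reached, where
`q(v)` is the second configuration. -/
def Covers (V : VASS d Q) (c c' : Q × (Fin d → ℕ)) : Prop :=
  ∃ v' : Fin d → ℕ, c'.2 ≤ v' ∧ V.Reach c (c'.1, v')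

/-- Every update has entries in `{-1, 0, 1}`. -/
def IsUnary (V : VASS d Q) : Prop :=
  ∀ t ∈ V.T, ∀ i, t.2.1 i = -1 ∨ t.2.1 i = 0 ∨ t.2.1 i = 1

/-- The size: the number of states plus the sum of the norms of the updates. -/
def size [Fintype Q] (V : VASS d Q) : ℕ :=
  Fintype.card Q + ∑ t ∈ V.T, vecNorm t.2.1

theorem IsUnary.size_eq [Fintype Q] {V : VASS d Q} (h : V.IsUnary) :
    V.size = Fintype.card Q + V.T.card := by
  have : ∀ t ∈ V.T, vecNorm t.2.1 = 1 := by
    intro t ht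
    refine max_eq_left (Finset.sup_le fun i _ => ?_)
    rcases h t ht i with h | h | h <;> simp [h]
  simp [size, Finset.sum_congr rfl this]

end VASS

/-- An instance of coverability in unary `d`-VASS: a unary `d`-VASS with states `0, …, q - 1`, given
by a list of its transitions, with an initial and a target configuration. -/
structure UnaryCoverInput (d : ℕ) where
  q : ℕ
  V : VASS d (Fin q)
  unary : V.IsUnary
  transitions : List (Fin q × (Fin d → ℤ) × Fin q)
  nodup : transitions.Nodup
  mem_transitions : ∀ t, t ∈ transitions ↔ t ∈ V.T
  source : Fin q × (Fin d → ℕ)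
  target : Fin q × (Fin d → ℕ)

namespace UnaryCoverInput

variable {d : ℕ}

/-- The size of the instance: that of the VASS plus the norms of the two vectors. -/
def size (x : UnaryCoverInput d) : ℕ :=
  x.V.size + vecNorm (fun i => (x.source.2 i : ℤ)) + vecNorm (fun i => (x.target.2 i : ℤ))

/-- State followed by counter values. -/
def encodeConfig {q : ℕ} (c : Fin q × (Fin d → ℕ)) : List ℕ :=
  c.1.val :: List.ofFn c.2

/-- The states of a transition around its update; the entries `-1, 0, 1` become `0, 1, 2`. -/
def encodeTransition {q : ℕ} (t : Fin q × (Fin d → ℤ) × Fin q) : List ℕ :=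
  t.1.val :: (List.ofFn fun i => (t.2.1 i + 1).toNat) ++ [t.2.2.val]

/-- Number of states, number of transitions, the two configurations, and the transitions. -/
def encode (x : UnaryCoverInput d) : List ℕ :=
  [x.q, x.transitions.length] ++ encodeConfig x.source ++ encodeConfig x.target ++
    x.transitions.flatMap encodeTransition

end UnaryCoverInput

/-! A cycle of length `k` is searched for by colour coding. Each colouring assigns numbers below `2
^ k` to the vertices; a closed walk whose `i`-th vertex has colour `i` for all `i < k` cannot repeat
a vertex, hence is a simple cycle. Conversely, a family of polylogarithmically many colourings gives
every `k` distinct vertices the colours `0, …, k - 1` in order (`exists_colouring`): among the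
roughly `log m` bits of a vertex name, `k * k` positions suffice to separate `k` names pairwise, and
a table of constant size turns the bits read there into colours.

All colourings are handled by one 2-VASS. Pairs of a colouring and a vertex are the `Z` slots of a
layer, and there are `k + 1` layers. A chain with updates `(1, -1)` runs up through layer `0`, graph
edges lead from layer `i` to layer `i + 1` within one colouring, and a chain with updates `(-1, 1)`
runs down through layer `k`. The counters start at `(0, Z)` and no transition increases their sum.
On leaving layer `0` the first counter stores the slot that was left, and coming down to slot `0` of
layer `k` with counters at least `(0, Z)` is possible only if layer `k` was entered at that same
slot. So coverability says exactly that a correctly coloured walk closes up (`covers_coverInput`,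
`covers_iff`). Edges with wrong colours become transitions `(-1, -1)`, which lower the sum for good
and are therefore useless.

The instance has size at most a constant times `(m + 1) ^ (1 + δ)` for any fixed `δ > 0`
(`exists_G_le`), so an algorithm of exponent `2 - ε` for coverability yields one of exponent below
`2` for `k`-cycles. Time is measured in `m`, while the number `n` of vertices may be far larger.
Vertices are therefore renamed to addresses of the input at which they occur.

The rest makes this precise on the word RAM. A small structured language is compiled to the machine
(`Stmt.Run.exec`), the reduction is written in it and verified (`wp_reduction`), and the given
coverability program is appended with its memory shifted behind the reduction's data
(`haltsIn_link_init`). `decidable_hasCycle` assembles the pieces. -/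

/-! ### Code fragments -/

namespace WordRAM

/-- Renaming of labels. -/
def Instr.map {L L' : Type} (f : L → L') : Instr L → Instr L'
  | .halt b => .halt b
  | .const dst v next => .const dst v (f next)
  | .op o dst a b next => .op o dst a b (f next)
  | .load dst addr next => .load dst addr (f next)
  | .store addr src next => .store addr src (f next)
  | .branchLt a b yes no => .branchLt a b (f yes) (f no)
  | .branchEq a b yes no => .branchEq a b (f yes) (f no)

theorem Instr.map_map {L L' L'' : Type} (f : L → L') (g : L' → L'') (i : Instr L) :
    (i.map f).map g = i.map (g ∘ f) := by
  cases i <;> rfl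

theorem Instr.map_congr {L L' : Type} {f g : L → L'} (h : ∀ l, f l = g l) (i : Instr L) :
    i.map f = i.map g := by
  rw [funext h]

/-- The second configuration is reached from the first one in exactly `t` steps. -/
def Steps (P : Program) (w : ℕ) : ℕ → Config P → Config P → Prop
  | 0, c, c' => c = c'
  | t + 1, c, c' => ∃ d, step P w c = some d ∧ Steps P w t d c'

theorem Steps.trans {P : Program} {w t t' : ℕ} {c d e : Config P} (h : Steps P w t c d)
    (h' : Steps P w t' d e) : Steps P w (t + t') c e := by
  induction t generalizing c with
  | zero => cases h; simpa using h'
  | succ t ih =>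
    obtain ⟨c', hc, hs⟩ := h
    rw [Nat.succ_add]
    exact ⟨c', hc, ih hs⟩

theorem Steps.single {P : Program} {w : ℕ} {c d : Config P} (h : step P w c = some d) :
    Steps P w 1 c d :=
  ⟨d, h, rfl⟩

theorem Steps.haltsIn {P : Program} {w t t' : ℕ} {c d : Config P} {b : Bool}
    (h : Steps P w t c d) (h' : HaltsIn P w d t' b) : HaltsIn P w c (t + t') b := by
  induction t generalizing c with
  | zero => cases h; simpa using h'
  | succ t ih =>
    obtain ⟨c', hc, hs⟩ := h
    have := HaltsIn.step hc (ih hs)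
    convert this using 1
    omega

/-- A piece of code with one entry and one exit; a jump to `none` leaves it. -/
structure Frag where
  Label : Type
  finite : Finite Label
  start : Label
  instr : Label → Instr (Option Label)

/-- `P` contains the code `F` at the labels `e`, and continues at `x` behind it. -/
def Frag.Embeds (F : Frag) (P : Program) (e : F.Label → P.Label) (x : P.Label) : Prop :=
  ∀ l, P.instr (e l) = (F.instr l).map fun o => o.elim x e

/-- In every program that contains `F`, running `F` takes `t` steps and has the given effect on
registers and memory. -/
def Frag.Exec (F : Frag) (w : ℕ) (reg mem : ℕ → ℕ) (t : ℕ) (reg' mem' : ℕ → ℕ) : Prop :=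
  ∀ (P : Program) (e : F.Label → P.Label) (x : P.Label), F.Embeds P e x →
    Steps P w t ⟨e F.start, reg, mem⟩ ⟨x, reg', mem'⟩

/-- A single instruction. -/
def Frag.atom (i : Instr (Option Unit)) : Frag := ⟨Unit, inferInstance, (), fun _ => i⟩

/-- One piece of code after the other. -/
def Frag.seq (F G : Frag) : Frag where
  Label := F.Label ⊕ G.Label
  finite := by
    have := F.finite
    have := G.finite
    infer_instance
  start := .inl F.start
  instr
    | .inl l => (F.instr l).map fun o => some (o.elim (.inr G.start) .inl)
    | .inr l => (G.instr l).map (Option.map .inr)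

/-- Repetition of a piece of code while one register is smaller than another one. -/
def Frag.loop (a b : ℕ) (F : Frag) : Frag where
  Label := Option F.Label
  finite := by
    have := F.finite
    infer_instance
  start := none
  instr
    | none => .branchLt a b (some (some F.start)) none
    | some l => (F.instr l).map some

namespace Frag

variable {F G : Frag} {w t t' : ℕ} {reg mem reg' mem' reg'' mem'' : ℕ → ℕ}

theorem Exec.seq (h : F.Exec w reg mem t reg' mem') (h' : G.Exec w reg' mem' t' reg'' mem'') :
    (F.seq G).Exec w reg mem (t + t') reg'' mem'' := by
  intro P e x hP
  refine (h P (e ∘ .inl) (e (.inr G.start)) ?_).trans (h' P (e ∘ .inr) x ?_)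
  · intro l
    refine (hP (.inl l)).trans ?_
    simp only [Frag.seq, Instr.map_map]
    exact Instr.map_congr (fun o => by cases o <;> rfl) _
  · intro l
    refine (hP (.inr l)).trans ?_
    simp only [Frag.seq, Instr.map_map]
    exact Instr.map_congr (fun o => by cases o <;> rfl) _

theorem Exec.loop_done {a b : ℕ} (h : ¬ reg a < reg b) :
    (F.loop a b).Exec w reg mem 1 reg mem := by
  intro P e x hP
  apply Steps.single
  have := hP none
  simp only [Frag.loop, Instr.map] at this
  simp [step, Frag.loop, this, h]
  rfl

theorem Exec.loop_again {a b : ℕ} (h : reg a < reg b) (h1 : F.Exec w reg mem t reg' mem')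
    (h2 : (F.loop a b).Exec w reg' mem' t' reg'' mem'') :
    (F.loop a b).Exec w reg mem (1 + t + t') reg'' mem'' := by
  intro P e x hP
  refine (Steps.trans (Steps.single (d := ⟨e (some F.start), reg, mem⟩) ?_)
    (h1 P (e ∘ some) (e none) ?_)).trans (h2 P e x hP)
  · have := hP none
    simp only [Frag.loop, Instr.map] at this
    simp [step, Frag.loop, this, h]
    rfl
  · intro l
    refine (hP (some l)).trans ?_
    simp only [Frag.loop, Instr.map_map]
    exact Instr.map_congr (fun o => by cases o <;> rfl) _

theorem exec_const {d v : ℕ} (h : v < 2 ^ w) :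
    (atom (.const d v none)).Exec w reg mem 1 (Function.update reg d v) mem := by
  intro P e x hP
  apply Steps.single
  have := hP ()
  simp only [atom, Instr.map] at this
  simp [step, atom, this, h]
  rfl

theorem exec_op {o : BinOp} {d a b : ℕ} (h : o.eval (reg a) (reg b) < 2 ^ w) :
    (atom (.op o d a b none)).Exec w reg mem 1
      (Function.update reg d (o.eval (reg a) (reg b))) mem := by
  intro P e x hP
  apply Steps.single
  have := hP ()
  simp only [atom, Instr.map] at this
  simp [step, atom, this, h]
  rfl

/-- The machine has no move instruction; the bitwise `and` of a word with itself serves as one. -/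
theorem exec_copy {d a : ℕ} (h : reg a < 2 ^ w) :
    (atom (.op .and d a a none)).Exec w reg mem 1 (Function.update reg d (reg a)) mem := by
  have h' : BinOp.and.eval (reg a) (reg a) = reg a := Nat.and_self _
  have := exec_op (mem := mem) (d := d) (o := .and) (a := a) (b := a) (by rw [h']; exact h)
  rwa [h'] at this

theorem exec_load {d a : ℕ} :
    (atom (.load d a none)).Exec w reg mem 1 (Function.update reg d (mem (reg a))) mem := by
  intro P e x hP
  apply Steps.single
  have := hP ()
  simp only [atom, Instr.map] at this
  simp [step, atom, this]
  rfl

theorem exec_store {a b : ℕ} :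
    (atom (.store a b none)).Exec w reg mem 1 reg (Function.update mem (reg a) (reg b)) := by
  intro P e x hP
  apply Steps.single
  have := hP ()
  simp only [atom, Instr.map] at this
  simp [step, atom, this]
  rfl

end Frag

/-! ### Expressions -/

/-- The operations whose result is at most polynomial in the operands. -/
inductive Arith
  | add | sub | mul | div | mod | shiftRight

/-- The corresponding word operation. -/
def Arith.toBinOp : Arith → BinOp
  | .add => .add
  | .sub => .sub
  | .mul => .mul
  | .div => .div
  | .mod => .mod
  | .shiftRight => .shiftRight

/-- Values of the variables, and memory. -/
structure State where
  var : ℕ → ℕ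
  mem : ℕ → ℕ

/-- Assignment to a variable. -/
def State.set (s : State) (r v : ℕ) : State := ⟨Function.update s.var r v, s.mem⟩

/-- Assignment to a memory cell. -/
def State.poke (s : State) (a v : ℕ) : State := ⟨s.var, Function.update s.mem a v⟩

/-- All the values are at most `B`. -/
def State.Bdd (s : State) (B : ℕ) : Prop := (∀ i, s.var i ≤ B) ∧ ∀ a, s.mem a ≤ B

theorem State.Bdd.set {s : State} {B r v : ℕ} (h : s.Bdd B) (hv : v ≤ B) : (s.set r v).Bdd B := by
  refine ⟨fun i => ?_, h.2⟩
  by_cases hi : i = r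
  · simp [State.set, hi, hv]
  · simp [State.set, hi, h.1 i]

theorem State.Bdd.poke {s : State} {B a v : ℕ} (h : s.Bdd B) (hv : v ≤ B) :
    (s.poke a v).Bdd B := by
  refine ⟨h.1, fun i => ?_⟩
  by_cases hi : i = a
  · simp [State.poke, hi, hv]
  · simp [State.poke, hi, h.2 i]

/-- Arithmetic expressions over variables and memory cells. -/
inductive Expr
  | var (i : ℕ)
  | const (c : ℕ)
  | bin (o : Arith) (a b : Expr)
  | load (a : Expr)

namespace Expr

def eval (s : State) : Expr → ℕ
  | var i => s.var i
  | const c => c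
  | bin o a b => o.toBinOp.eval (a.eval s) (b.eval s)
  | load a => s.mem (a.eval s)

/-- The number of instructions of the compiled expression. -/
def cost : Expr → ℕ
  | var _ => 1
  | const _ => 1
  | bin _ a b => a.cost + b.cost + 1
  | load a => a.cost + 1

/-- If variables and memory are bounded by `B ≥ 2`, then the value is at most `B ^ weight`. -/
def weight : Expr → ℕ
  | var _ => 1
  | const c => c + 1
  | bin _ a b => a.weight + b.weight
  | load a => a.weight + 1

/-- Every intermediate result is a word. -/
def Fits (w : ℕ) (s : State) : Expr → Prop
  | var i => s.var i < 2 ^ w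
  | const c => c < 2 ^ w
  | bin o a b => a.Fits w s ∧ b.Fits w s ∧ o.toBinOp.eval (a.eval s) (b.eval s) < 2 ^ w
  | load a => a.Fits w s

/-- Code that evaluates the expression into register `3 * d + 1`; variable `i` lives in register
`3 * i`. -/
def compile : Expr → ℕ → Frag
  | var i, d => .atom (.op .and (3 * d + 1) (3 * i) (3 * i) none)
  | const c, d => .atom (.const (3 * d + 1) c none)
  | bin o a b, d => ((a.compile d).seq (b.compile (d + 1))).seq
      (.atom (.op o.toBinOp (3 * d + 1) (3 * d + 1) (3 * (d + 1) + 1) none))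
  | load a, d => (a.compile d).seq (.atom (.load (3 * d + 1) (3 * d + 1) none))

theorem weight_pos (e : Expr) : 1 ≤ e.weight := by
  induction e <;> simp only [weight] <;> omega

/-- A product is a common bound for all the operations, which is why weights add up under `bin`. For
sums this needs both factors to be at least `2`. -/
theorem arith_le (o : Arith) {a b x y : ℕ} (ha : a ≤ x) (hb : b ≤ y) (hx : 2 ≤ x) (hy : 2 ≤ y) :
    o.toBinOp.eval a b ≤ x * y := by
  have h1 : x ≤ x * y := Nat.le_mul_of_pos_right _ (by omega)
  have h2 : x + y ≤ x * y := by nlinarith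
  cases o <;> simp only [Arith.toBinOp, BinOp.eval]
  · omega
  · omega
  · exact Nat.mul_le_mul ha hb
  · exact (Nat.div_le_self _ _).trans (by omega)
  · exact (Nat.mod_le _ _).trans (by omega)
  · rw [Nat.shiftRight_eq_div_pow]
    exact (Nat.div_le_self _ _).trans (by omega)

theorem eval_le {B : ℕ} (hB : 2 ≤ B) {s : State} (hs : s.Bdd B) (e : Expr) :
    e.eval s ≤ B ^ e.weight := by
  have hB1 : ∀ j, 1 ≤ j → B ≤ B ^ j := fun j hj => Nat.le_self_pow (by omega) B
  induction e with
  | var i => simpa [eval, weight] using hs.1 i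
  | const c =>
    have h1 : c < 2 ^ c := Nat.lt_two_pow_self
    have h2 : 2 ^ c ≤ B ^ c := Nat.pow_le_pow_left hB c
    have h3 : B ^ c ≤ B ^ (c + 1) := Nat.pow_le_pow_right (by omega) (by omega)
    simp only [eval, weight]
    omega
  | bin o a b iha ihb =>
    simp only [eval, weight, pow_add]
    exact arith_le o iha ihb (hB.trans (hB1 _ a.weight_pos)) (hB.trans (hB1 _ b.weight_pos))
  | load a _ => exact (hs.2 _).trans (hB1 _ (by simp [weight]))

theorem fits {B w : ℕ} (hB : 2 ≤ B) {s : State} (hs : s.Bdd B) (e : Expr)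
    (h : B ^ e.weight < 2 ^ w) : e.Fits w s := by
  induction e with
  | var i => exact (eval_le hB hs (var i)).trans_lt h
  | const c => exact (eval_le hB hs (const c)).trans_lt h
  | bin o a b iha ihb =>
    have ha : B ^ a.weight ≤ B ^ (bin o a b).weight :=
      Nat.pow_le_pow_right (by omega) (by simp [weight])
    have hb : B ^ b.weight ≤ B ^ (bin o a b).weight :=
      Nat.pow_le_pow_right (by omega) (by simp [weight])
    exact ⟨iha (ha.trans_lt h), ihb (hb.trans_lt h), (eval_le hB hs (bin o a b)).trans_lt h⟩
  | load a ih =>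
    have ha : B ^ a.weight ≤ B ^ (load a).weight :=
      Nat.pow_le_pow_right (by omega) (by simp [weight])
    exact ih (ha.trans_lt h)

/-- The frame condition carries the induction: the left operand in register `3 * d + 1` survives the
evaluation of the right one at depth `d + 1`, and registers that are `0` or `2` modulo `3` are never
touched. -/
theorem exec_compile {w : ℕ} {s : State} (e : Expr) (d : ℕ) (reg : ℕ → ℕ)
    (hreg : ∀ i, reg (3 * i) = s.var i) (h : e.Fits w s) :
    ∃ reg', (e.compile d).Exec w reg s.mem e.cost reg' s.mem ∧ reg' (3 * d + 1) = e.eval s ∧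
      ∀ r, r % 3 ≠ 1 ∨ r < 3 * d + 1 → reg' r = reg r := by
  induction e generalizing d reg with
  | var i =>
    refine ⟨_, Frag.exec_copy ?_, ?_, ?_⟩
    · rw [hreg]; exact h
    · simp [hreg, eval]
    · intro r hr
      exact Function.update_of_ne (by omega) _ _
  | const c =>
    refine ⟨_, Frag.exec_const h, ?_, ?_⟩
    · simp [eval]
    · intro r hr
      exact Function.update_of_ne (by omega) _ _
  | bin o a b iha ihb =>
    obtain ⟨ha, hb, ho⟩ := h
    obtain ⟨reg1, hx1, hv1, hf1⟩ := iha d reg hreg ha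
    obtain ⟨reg2, hx2, hv2, hf2⟩ := ihb (d + 1) reg1
      (fun i => by rw [hf1 _ (by omega), hreg]) hb
    have hv : reg2 (3 * d + 1) = a.eval s := by rw [hf2 _ (by omega), hv1]
    refine ⟨_, (hx1.seq hx2).seq (Frag.exec_op ?_), ?_, ?_⟩
    · rw [hv, hv2]; exact ho
    · simp [hv, hv2, eval]
    · intro r hr
      rw [Function.update_of_ne (by omega), hf2 _ (by omega), hf1 _ (by omega)]
  | load a iha =>
    obtain ⟨reg1, hx1, hv1, hf1⟩ := iha d reg hreg h
    refine ⟨_, hx1.seq Frag.exec_load, ?_, ?_⟩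
    · simp [hv1, eval]
    · intro r hr
      rw [Function.update_of_ne (by omega), hf1 _ (by omega)]

end Expr

/-! ### Structured programs -/

/-- Statements; `loop i j st` repeats `st` while variable `i` is smaller than variable `j`. -/
inductive Stmt
  | assign (r : ℕ) (e : Expr)
  | store (a e : Expr)
  | seq (st st' : Stmt)
  | loop (i j : ℕ) (st : Stmt)

namespace Stmt

def weight : Stmt → ℕ
  | assign _ e => e.weight
  | store a e => a.weight + e.weight
  | seq st st' => st.weight + st'.weight
  | loop _ _ st => st.weight

def compile : Stmt → Frag
  | assign r e => (e.compile 0).seq (.atom (.op .and (3 * r) 1 1 none))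
  | store a e => ((a.compile 0).seq (e.compile 1)).seq (.atom (.store 1 4 none))
  | seq st st' => st.compile.seq st'.compile
  | loop i j st => .loop (3 * i) (3 * j) st.compile

/-- Big-step semantics with the number of machine steps, along states bounded by `B`. -/
inductive Run (B : ℕ) : Stmt → State → ℕ → State → Prop
  | assign {r : ℕ} {e : Expr} {s : State} (h : s.Bdd B) :
      Run B (assign r e) s (e.cost + 1) (s.set r (e.eval s))
  | store {a e : Expr} {s : State} (h : s.Bdd B) :
      Run B (store a e) s (a.cost + e.cost + 1) (s.poke (a.eval s) (e.eval s))
  | seq {st st' : Stmt} {s s' s'' : State} {t t' : ℕ} (h : Run B st s t s')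
      (h' : Run B st' s' t' s'') : Run B (seq st st') s (t + t') s''
  | loop_done {i j : ℕ} {st : Stmt} {s : State} (h : ¬ s.var i < s.var j) :
      Run B (loop i j st) s 1 s
  | loop_again {i j : ℕ} {st : Stmt} {s s' s'' : State} {t t' : ℕ} (h : s.var i < s.var j)
      (h1 : Run B st s t s') (h2 : Run B (loop i j st) s' t' s'') :
      Run B (loop i j st) s (1 + t + t') s''

/-- The registers `3 * i` hold the variables, and the registers `3 * r + 2` hold `0`. -/
def Rep (s : State) (reg : ℕ → ℕ) : Prop :=
  (∀ i, reg (3 * i) = s.var i) ∧ ∀ r, reg (3 * r + 2) = 0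

/-- Since all states along the run are bounded by `B`, one inequality excludes overflow in every
instruction, however many rounds the loops make. Keeping the registers `3 * r + 2` at `0` prepares
the initial registers of a program that runs afterwards. -/
theorem Run.exec {B w : ℕ} (hB : 2 ≤ B) {st : Stmt} {s s' : State} {t : ℕ}
    (h : st.Run B s t s') (hw : B ^ st.weight < 2 ^ w) (reg : ℕ → ℕ) (hreg : Rep s reg) :
    ∃ reg', Rep s' reg' ∧ st.compile.Exec w reg s.mem t reg' s'.mem := by
  induction h generalizing reg with
  | @assign r e s hs =>
    obtain ⟨reg1, hx, hv, hf⟩ := e.exec_compile 0 reg hreg.1 (e.fits hB hs hw)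
    have hv' : reg1 1 = e.eval s := hv
    refine ⟨_, ?_, hx.seq (Frag.exec_copy ?_)⟩
    · refine ⟨fun i => ?_, fun i => ?_⟩
      · by_cases hi : i = r
        · simp [hi, hv', State.set]
        · rw [Function.update_of_ne (by omega), hf _ (by omega), hreg.1]
          simp [State.set, hi]
      · rw [Function.update_of_ne (by omega), hf _ (by omega), hreg.2]
    · rw [hv']
      exact (e.eval_le hB hs).trans_lt hw
  | @store a e s hs =>
    have ha : B ^ a.weight ≤ B ^ (Stmt.store a e).weight :=
      Nat.pow_le_pow_right (by omega) (by simp [weight])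
    have he : B ^ e.weight ≤ B ^ (Stmt.store a e).weight :=
      Nat.pow_le_pow_right (by omega) (by simp [weight])
    obtain ⟨reg1, hx1, hv1, hf1⟩ := a.exec_compile 0 reg hreg.1 (a.fits hB hs (ha.trans_lt hw))
    obtain ⟨reg2, hx2, hv2, hf2⟩ := e.exec_compile 1 reg1
      (fun i => by rw [hf1 _ (by omega), hreg.1]) (e.fits hB hs (he.trans_lt hw))
    have hv : reg2 1 = a.eval s := by rw [hf2 _ (by omega)]; exact hv1
    have hv' : reg2 4 = e.eval s := hv2
    refine ⟨reg2, ?_, ?_⟩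
    · refine ⟨fun i => ?_, fun i => ?_⟩
      · rw [hf2 _ (by omega), hf1 _ (by omega), hreg.1]
        rfl
      · rw [hf2 _ (by omega), hf1 _ (by omega), hreg.2]
    · have := (hx1.seq hx2).seq (Frag.exec_store (a := 1) (b := 4))
      rw [hv, hv'] at this
      exact this
  | @seq st st' s s' s'' t t' _ _ ih ih' =>
    have h1 : B ^ st.weight ≤ B ^ (Stmt.seq st st').weight :=
      Nat.pow_le_pow_right (by omega) (by simp [weight])
    have h2 : B ^ st'.weight ≤ B ^ (Stmt.seq st st').weight :=
      Nat.pow_le_pow_right (by omega) (by simp [weight])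
    obtain ⟨reg1, hr1, hx1⟩ := ih (h1.trans_lt hw) reg hreg
    obtain ⟨reg2, hr2, hx2⟩ := ih' (h2.trans_lt hw) reg1 hr1
    exact ⟨reg2, hr2, hx1.seq hx2⟩
  | loop_done hlt =>
    refine ⟨reg, hreg, Frag.Exec.loop_done ?_⟩
    rwa [hreg.1, hreg.1]
  | loop_again hlt _ _ ih ih' =>
    obtain ⟨reg1, hr1, hx1⟩ := ih hw reg hreg
    obtain ⟨reg2, hr2, hx2⟩ := ih' hw reg1 hr1
    refine ⟨reg2, hr2, Frag.Exec.loop_again ?_ hx1 hx2⟩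
    rwa [hreg.1, hreg.1]

/-- From `s`, the statement runs for at most `T` steps along states bounded by `B`, and ends in a
state with `Q`. -/
def Wp (B : ℕ) (st : Stmt) (T : ℕ) (Q : State → Prop) (s : State) : Prop :=
  ∃ t s', st.Run B s t s' ∧ t ≤ T ∧ s'.Bdd B ∧ Q s'

variable {B T T' : ℕ} {Q Q' : State → Prop} {s : State}

theorem wp_assign {r : ℕ} {e : Expr} (hs : s.Bdd B) (he : e.eval s ≤ B)
    (h : Q (s.set r (e.eval s))) : Wp B (assign r e) (e.cost + 1) Q s :=
  ⟨_, _, .assign hs, le_rfl, hs.set he, h⟩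

theorem wp_store {a e : Expr} (hs : s.Bdd B) (he : e.eval s ≤ B)
    (h : Q (s.poke (a.eval s) (e.eval s))) : Wp B (store a e) (a.cost + e.cost + 1) Q s :=
  ⟨_, _, .store hs, le_rfl, hs.poke he, h⟩

theorem wp_seq {st st' : Stmt} (h : Wp B st T Q s)
    (h' : ∀ s', s'.Bdd B → Q s' → Wp B st' T' Q' s') : Wp B (seq st st') (T + T') Q' s := by
  obtain ⟨t, s', hr, ht, hb, hq⟩ := h
  obtain ⟨t', s'', hr', ht', hb', hq'⟩ := h' s' hb hq
  exact ⟨_, _, hr.seq hr', by omega, hb', hq'⟩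

theorem Wp.mono {st : Stmt} (h : Wp B st T Q s) (hT : T ≤ T') (hQ : ∀ s', Q s' → Q' s') :
    Wp B st T' Q' s := by
  obtain ⟨t, s', hr, ht, hb, hq⟩ := h
  exact ⟨t, s', hr, ht.trans hT, hb, hQ _ hq⟩

/-- The invariant is indexed by the round, and the number of rounds is known beforehand; this
replaces a termination argument. The extra steps are the evaluations of the loop test. -/
theorem wp_loop {i j : ℕ} {st : Stmt} (n : ℕ) (I : ℕ → State → Prop) (hs : s.Bdd B) (h0 : I 0 s)
    (hlt : ∀ l < n, ∀ s, I l s → s.var i < s.var j) (hn : ∀ s, I n s → ¬ s.var i < s.var j)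
    (hI : ∀ l < n, ∀ s, s.Bdd B → I l s → Wp B st T (I (l + 1)) s) :
    Wp B (loop i j st) (n * (T + 1) + 1) (I n) s := by
  suffices h : ∀ d l s, l + d = n → s.Bdd B → I l s →
      Wp B (loop i j st) (d * (T + 1) + 1) (I n) s from h n 0 s (by omega) hs h0
  intro d
  induction d with
  | zero =>
    intro l s hl hs hi
    obtain rfl : l = n := by omega
    exact ⟨1, s, .loop_done (hn s hi), by omega, hs, hi⟩
  | succ d ih =>
    intro l s hl hs hi
    obtain ⟨t, s', hr, ht, hb, hq⟩ := hI l (by omega) s hs hi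
    obtain ⟨t', s'', hr', ht', hb', hq'⟩ := ih (l + 1) s' (by omega) hb hq
    exact ⟨_, s'', .loop_again (hlt l (by omega) s hi) hr hr', by nlinarith, hb', hq'⟩

end Stmt

/-! ### A program behind a statement, with shifted memory -/

/-- First the statement `st`, and then the program `P`, whose memory is shifted by the value of the
variable `v`, and whose register `r` is the register `3 * r + 2`. -/
def link (st : Stmt) (v : ℕ) (P : Program) : Program where
  Label := st.compile.Label ⊕ P.Label × Bool
  finite := by
    have := st.compile.finite
    have := P.finite
    infer_instance
  start := .inl st.compile.start
  instr
    | .inl l => (st.compile.instr l).map fun o => o.elim (.inr (P.start, false)) .inl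
    | .inr (l, b) =>
      match P.instr l with
      | .halt a => .halt a
      | .const dst c next => .const (3 * dst + 2) c (.inr (next, false))
      | .op o dst x y next => .op o (3 * dst + 2) (3 * x + 2) (3 * y + 2) (.inr (next, false))
      | .load dst addr next =>
        match b with
        | false => .op .add 1 (3 * addr + 2) (3 * v) (.inr (l, true))
        | true => .load (3 * dst + 2) 1 (.inr (next, false))
      | .store addr src next =>
        match b with
        | false => .op .add 1 (3 * addr + 2) (3 * v) (.inr (l, true))
        | true => .store 1 (3 * src + 2) (.inr (next, false))
      | .branchLt x y yes no =>
        .branchLt (3 * x + 2) (3 * y + 2) (.inr (yes, false)) (.inr (no, false))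
      | .branchEq x y yes no =>
        .branchEq (3 * x + 2) (3 * y + 2) (.inr (yes, false)) (.inr (no, false))

/-- The configuration of the linked program represents the one of `P`. -/
structure Sim {st : Stmt} {v : ℕ} {P : Program} (S : ℕ) (c : Config P)
    (c' : Config (link st v P)) : Prop where
  label : c'.label = .inr (c.label, false)
  reg : ∀ r, c'.reg (3 * r + 2) = c.reg r
  base : c'.reg (3 * v) = S
  mem : ∀ a, c'.mem (S + a) = c.mem a

/-- Registers and memory are bounded by `X`. -/
def Config.Bdd {P : Program} (c : Config P) (X : ℕ) : Prop :=
  (∀ r, c.reg r ≤ X) ∧ ∀ a, c.mem a ≤ X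

theorem update_le {f : ℕ → ℕ} {X a v : ℕ} (h : ∀ i, f i ≤ X) (hv : v ≤ X) (i : ℕ) :
    Function.update f a v i ≤ X := by
  by_cases hi : i = a
  · simp [hi, hv]
  · simp [hi, h i]

/-- The bound may have to exceed `2 ^ w`, because the input cells are not required to be `w`-bit
words. A step either writes a checked value or moves one that is already present. -/
theorem step_bdd {P : Program} {w X : ℕ} {c d : Config P} (hX : 2 ^ w ≤ X) (hc : c.Bdd X)
    (h : step P w c = some d) : d.Bdd X := by
  unfold step at h
  split at h
  · cases h
  · split at h <;> cases h
    exact ⟨update_le hc.1 (by omega), hc.2⟩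
  · split at h <;> cases h
    exact ⟨update_le hc.1 (by omega), hc.2⟩
  · cases h
    exact ⟨update_le hc.1 (hc.2 _), hc.2⟩
  · cases h
    exact ⟨hc.1, update_le hc.2 (hc.1 _)⟩
  · cases h
    exact hc
  · cases h
    exact hc

theorem update_guest {f g : ℕ → ℕ} (h : ∀ r, f (3 * r + 2) = g r) (d x r : ℕ) :
    Function.update f (3 * d + 2) x (3 * r + 2) = Function.update g d x r := by
  by_cases hr : r = d
  · simp [hr]
  · rw [Function.update_of_ne (by omega), Function.update_of_ne hr, h]

/-- Only memory accesses cost a second step, for adding the base to the address. The shifted address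
goes to register `1`, which is neither a guest register `3 * r + 2` nor the base register `3 * v`.
-/
theorem step_link {st : Stmt} {v S w w' X : ℕ} {P : Program} (hw : w ≤ w')
    (hS : X + S < 2 ^ w') {c d : Config P} {c' : Config (link st v P)} (hc : c.Bdd X)
    (hs : Sim S c c') (h : step P w c = some d) :
    ∃ t ≤ 2, ∃ d', Steps (link st v P) w' t c' d' ∧ Sim S d d' := by
  have hpow : 2 ^ w ≤ 2 ^ w' := Nat.pow_le_pow_right (by omega) hw
  obtain ⟨l, reg, mem⟩ := c
  obtain ⟨l', reg', mem'⟩ := c'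
  obtain ⟨h1, h2, h3, h4⟩ := hs
  simp only at h1 h2 h3 h4
  subst h1
  unfold step at h
  simp only at h
  cases hi : P.instr l with
  | halt a => simp [hi] at h
  | const dst x next =>
    simp only [hi] at h
    split at h <;> cases h
    refine ⟨1, by omega, ⟨.inr (next, false), _, mem'⟩, Steps.single (by
      simp only [step, link, hi]; rw [if_pos (by omega)]),
      rfl, update_guest h2 _ _, ?_, h4⟩
    simp only
    rw [Function.update_of_ne (by omega), h3]
  | op o dst x y next =>
    simp only [hi] at h
    split at h <;> cases h
    refine ⟨1, by omega, ⟨.inr (next, false), _, mem'⟩, Steps.single (by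
      simp only [step, link, hi, h2]; rw [if_pos (by omega)]),
      rfl, update_guest h2 _ _, ?_, h4⟩
    simp only
    rw [Function.update_of_ne (by omega), h3]
  | load dst addr next =>
    simp only [hi] at h
    cases h
    have hb := hc.1 addr
    simp only at hb
    refine ⟨2, by omega, ⟨.inr (next, false), Function.update (Function.update reg' 1
      (reg addr + S)) (3 * dst + 2) (mem (reg addr)), mem'⟩, ⟨⟨.inr (l, true), Function.update reg' 1
      (reg addr + S), mem'⟩, ?_, Steps.single ?_⟩, rfl, ?_, ?_, h4⟩
    · simp only [step, link, hi, h2, h3, BinOp.eval]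
      rw [if_pos (by omega)]
    · simp only [step, link, hi, Function.update_self]
      rw [Nat.add_comm (reg addr) S, h4]
    · refine update_guest (fun r => ?_) _ _
      rw [Function.update_of_ne (by omega), h2]
    · simp only
      rw [Function.update_of_ne (by omega), Function.update_of_ne (by omega), h3]
  | store addr src next =>
    simp only [hi] at h
    cases h
    have hb := hc.1 addr
    simp only at hb
    refine ⟨2, by omega, ⟨.inr (next, false), Function.update reg' 1 (reg addr + S),
      Function.update mem' (reg addr + S) (reg src)⟩, ⟨⟨.inr (l, true), Function.update reg' 1
      (reg addr + S), mem'⟩, ?_, Steps.single ?_⟩, rfl, ?_, ?_, ?_⟩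
    · simp only [step, link, hi, h2, h3, BinOp.eval]
      rw [if_pos (by omega)]
    · simp only [step, link, hi, Function.update_self]
      rw [Function.update_of_ne (by omega), h2]
    · intro r
      simp only
      rw [Function.update_of_ne (by omega), h2]
    · simp only
      rw [Function.update_of_ne (by omega), h3]
    · intro a
      simp only
      by_cases ha : a = reg addr
      · simp [ha, Nat.add_comm]
      · rw [Function.update_of_ne (by omega), Function.update_of_ne ha, h4]
  | branchLt x y yes no =>
    simp only [hi] at h
    cases h
    refine ⟨1, by omega, ⟨.inr (if reg x < reg y then yes else no, false), reg', mem'⟩,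
      Steps.single ?_, rfl, h2, h3, h4⟩
    simp only [step, link, hi, h2]
    split <;> rfl
  | branchEq x y yes no =>
    simp only [hi] at h
    cases h
    refine ⟨1, by omega, ⟨.inr (if reg x = reg y then yes else no, false), reg', mem'⟩,
      Steps.single ?_, rfl, h2, h3, h4⟩
    simp only [step, link, hi, h2]
    split <;> rfl

theorem haltsIn_link {st : Stmt} {v S w w' X : ℕ} {P : Program} (hw : w ≤ w') (hX : 2 ^ w ≤ X)
    (hS : X + S < 2 ^ w') {c : Config P} {t : ℕ} {b : Bool} (h : HaltsIn P w c t b)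
    {c' : Config (link st v P)} (hc : c.Bdd X) (hs : Sim S c c') :
    ∃ t' ≤ 2 * t, HaltsIn (link st v P) w' c' t' b := by
  induction h generalizing c' with
  | @halt c b h =>
    refine ⟨1, by omega, .halt ?_⟩
    simp [hs.label, link, h]
  | @step c d t b h _ ih =>
    obtain ⟨t1, ht1, d', hd', hsd⟩ := step_link hw hS hc hs h
    obtain ⟨t2, ht2, hh⟩ := ih (step_bdd hX hc h) hsd
    exact ⟨t1 + t2, by omega, hd'.haltsIn hh⟩

/-- If `st` writes the input of `P` behind the address in variable `v`, then the linked program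
answers like `P`. -/
theorem haltsIn_link_init {st : Stmt} {v w w' X B T t : ℕ} {P : Program} {b : Bool}
    {input input' : List ℕ} (hB : 2 ≤ B) (hBw : B ^ st.weight < 2 ^ w') (hw : w ≤ w')
    (hX : 2 ^ w ≤ X) (hX' : B ≤ X) (hXB : X + B < 2 ^ w')
    (hst : st.Wp B T (fun s => ∀ i, s.mem (s.var v + i) = input'.getD i 0)
      ⟨fun _ => 0, fun i => input.getD i 0⟩)
    (h : HaltsIn P w (init P input') t b) :
    ∃ t' ≤ T + 2 * t, HaltsIn (link st v P) w' (init (link st v P) input) t' b := by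
  obtain ⟨t1, s', hr, ht1, hb, hq⟩ := hst
  obtain ⟨reg', hrep, hx⟩ := hr.exec hB hBw (fun _ => 0) ⟨fun _ => rfl, fun _ => rfl⟩
  have hsteps := hx (link st v P) .inl (.inr (P.start, false)) (fun l => rfl)
  have hbase := hrep.1 v
  obtain ⟨t2, ht2, hh⟩ := haltsIn_link (st := st) (v := v) (S := s'.var v) hw hX
    (by have := hb.1 v; omega) h (c' := ⟨.inr (P.start, false), reg', s'.mem⟩)
    ⟨fun r => Nat.zero_le _, fun a => (hq a).symm.trans_le ((hb.2 _).trans hX')⟩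
    ⟨rfl, fun r => hrep.2 r, hbase, hq⟩
  exact ⟨t1 + t2, by omega, hsteps.haltsIn hh⟩

end WordRAM

/-! ### The reduction as a program -/

namespace WordRAM

open Function

/-- A sequence of assignments. -/
def assigns : List (ℕ × Expr) → Stmt
  | [] => .assign 0 (.var 0)
  | (r, e) :: es => .seq (.assign r e) (assigns es)

/-- The effect of a sequence of assignments. -/
def State.run (s : State) : List (ℕ × Expr) → State
  | [] => s
  | (r, e) :: es => (s.set r (e.eval s)).run es

/-- All the assigned values are at most `B`. -/
def AllLe (B : ℕ) : State → List (ℕ × Expr) → Prop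
  | _, [] => True
  | s, (r, e) :: es => e.eval s ≤ B ∧ AllLe B (s.set r (e.eval s)) es

/-- The final `2` pays for the self-assignment that stands for the empty sequence. -/
def assignsCost (es : List (ℕ × Expr)) : ℕ := (es.map fun e => e.2.cost + 1).sum + 2

theorem wp_assigns {B : ℕ} (es : List (ℕ × Expr)) {s : State} (hs : s.Bdd B)
    (h : AllLe B s es) : (assigns es).Wp B (assignsCost es) (fun s' => s' = s.run es) s := by
  induction es generalizing s with
  | nil =>
    have : s.set 0 (s.var 0) = s := by simp [State.set]
    refine (Stmt.wp_assign (e := .var 0) (Q := fun s' => s' = s) hs (hs.1 0) this).mono ?_ fun _ h => h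
    simp [assignsCost, Expr.cost]
  | cons re es ih =>
    refine (Stmt.wp_seq (Q := fun s' => s' = s.set re.1 (re.2.eval s)) (Stmt.wp_assign hs h.1 rfl)
      ?_).mono (T := re.2.cost + 1 + assignsCost es) ?_ fun _ h => h
    · rintro _ hb rfl
      exact ih hb h.2
    · simp only [assignsCost, List.map_cons, List.sum_cons]
      omega

/-- The memory holds the list `l` at address `S`, and zeros behind it. -/
def Holds (mem : ℕ → ℕ) (S : ℕ) (l : List ℕ) : Prop := ∀ i, mem (S + i) = l.getD i 0

theorem Holds.snoc {mem : ℕ → ℕ} {S : ℕ} {l : List ℕ} (h : Holds mem S l) (v : ℕ) :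
    Holds (update mem (S + l.length) v) S (l ++ [v]) := by
  intro i
  have hi := h i
  simp only [List.getD_eq_getElem?_getD] at hi ⊢
  rcases lt_trichotomy i l.length with h1 | h1 | h1
  · rw [update_of_ne (by omega), hi, List.getElem?_append_left h1]
  · simp [h1]
  · rw [update_of_ne (by omega), hi, List.getElem?_eq_none (by omega),
      List.getElem?_eq_none (by simp; omega)]

/-- Append the values of the variables `rs` at the address in variable `6`. -/
def emitAll : List ℕ → Stmt
  | [] => .assign 6 (.var 6)
  | r :: rs => .seq (.seq (.store (.var 6) (.var r))
      (.assign 6 (.bin .add (.var 6) (.const 1)))) (emitAll rs)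

/-- Compared to `s`, the list that is written at `S` has grown from `l` to `l ++ l'`. -/
structure Emitted (S : ℕ) (l l' : List ℕ) (s s' : State) : Prop where
  ptr : s'.var 6 = S + (l ++ l').length
  holds : Holds s'.mem S (l ++ l')
  var : ∀ i, i ≠ 6 → s'.var i = s.var i
  mem : ∀ a < S, s'.mem a = s.mem a

/-- Each value costs `3` steps for the store and `4` for advancing the pointer; the closing
self-assignment costs `2`. -/
theorem wp_emitAll {B S : ℕ} (rs : List ℕ) (h6 : 6 ∉ rs) {l : List ℕ} {s : State} (hs : s.Bdd B)
    (hp : s.var 6 = S + l.length) (hl : Holds s.mem S l) (hB : S + l.length + rs.length ≤ B) :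
    (emitAll rs).Wp B (7 * rs.length + 2) (Emitted S l (rs.map s.var) s) s := by
  induction rs generalizing l s with
  | nil =>
    refine Stmt.wp_assign hs (hs.1 _) ?_
    have : s.set 6 (s.var 6) = s := by simp [State.set]
    simp only [Expr.eval, this]
    exact ⟨by simpa using hp, by simpa using hl, fun _ _ => rfl, fun _ _ => rfl⟩
  | cons r rs ih =>
    simp only [List.length_cons] at hB
    rw [List.mem_cons, not_or] at h6
    have hcost : 7 * (r :: rs).length + 2 = (3 + 4) + (7 * rs.length + 2) := by
      simp only [List.length_cons]; omega
    rw [hcost]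
    refine Stmt.wp_seq (Q := fun s' => s' = (s.poke (S + l.length) (s.var r)).set 6
      (S + l.length + 1)) (Stmt.wp_seq (Q := fun s' => s' = s.poke (S + l.length) (s.var r))
      (Stmt.wp_store hs (hs.1 _) ?_) ?_) ?_
    · simp [Expr.eval, hp]
    · rintro _ hb rfl
      have he : (Expr.bin .add (.var 6) (.const 1)).eval (s.poke (S + l.length) (s.var r)) =
          S + l.length + 1 := by
        simp [Expr.eval, Arith.toBinOp, BinOp.eval, State.poke, hp]
      refine Stmt.wp_assign hb ?_ ?_
      · omega
      · rw [he]
    · rintro _ hb rfl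
      have hmap : rs.map ((s.poke (S + l.length) (s.var r)).set 6 (S + l.length + 1)).var =
          rs.map s.var := by
        refine List.map_congr_left fun i hi => ?_
        have : i ≠ 6 := fun h => h6.2 (h ▸ hi)
        simp [State.set, State.poke, this]
      refine (ih (l := l ++ [s.var r]) h6.2 hb ?_ (hl.snoc _) ?_).mono le_rfl ?_
      · simp [State.set]; omega
      · simp; omega
      · rw [hmap]
        intro s' h
        refine ⟨by simpa using h.ptr, by simpa using h.holds, fun i hi => ?_, fun a ha => ?_⟩
        · rw [h.var i hi]
          simp [State.set, State.poke, hi]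
        · rw [h.mem a ha]
          simp only [State.set, State.poke]
          rw [update_of_ne (by omega)]

/-! #### Derandomized colour coding -/

/-- The colour of `v` that is given by `g`: the `t` lowest digits of `g` in base `L` name bit
positions, the bits of `v` at these positions are the digits of an index (behind the digits of `p`),
and the remaining part of `g` is a table of colours. -/
def col (L k : ℕ) : ℕ → ℕ → ℕ → ℕ → ℕ
  | 0, g, p, _ => (g >>> (k * p)) % 2 ^ k
  | t + 1, g, p, v => col L k t (g / L) (2 * p + (v >>> (g % L)) % 2) v

/-! #### Expressions of the program -/

namespace Expr

/-- `1` if the two values are equal, and `0` otherwise. -/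
def eqE (a b : Expr) : Expr := .bin .sub (.const 1) (.bin .add (.bin .sub a b) (.bin .sub b a))

def powE (a : Expr) : ℕ → Expr
  | 0 => .const 1
  | t + 1 => .bin .mul (a.powE t) a

/-- The colour, with variable `3` for the base. -/
def colE (k : ℕ) : ℕ → Expr → Expr → Expr → Expr
  | 0, g, p, _ => .bin .mod (.bin .shiftRight g (.bin .mul (.const k) p)) (.const (2 ^ k))
  | t + 1, g, p, v => colE k t (.bin .div g (.var 3)) (.bin .add (.bin .mul (.const 2) p)
      (.bin .mod (.bin .shiftRight v (.bin .mod g (.var 3))) (.const 2))) v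

/-- With truncated subtraction, the sum of the two differences is the distance of the values, and
`1` minus it is the indicator of equality. -/
theorem eval_eqE (s : State) (a b : Expr) :
    (eqE a b).eval s = if a.eval s = b.eval s then 1 else 0 := by
  simp only [eqE, eval, Arith.toBinOp, BinOp.eval]
  split <;> omega

theorem eval_powE (s : State) (a : Expr) (t : ℕ) : (a.powE t).eval s = a.eval s ^ t := by
  induction t with
  | zero => simp [powE, eval]
  | succ t ih => simp [powE, eval, Arith.toBinOp, BinOp.eval, ih, pow_succ]

theorem eval_colE (s : State) (k t : ℕ) (g p v : Expr) :
    (colE k t g p v).eval s = col (s.var 3) k t (g.eval s) (p.eval s) (v.eval s) := by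
  induction t generalizing g p with
  | zero => simp [colE, col, eval, Arith.toBinOp, BinOp.eval]
  | succ t ih => simp [colE, col, ih, eval, Arith.toBinOp, BinOp.eval]

end Expr

/-! #### The output of the reduction -/

/-- A graph with `n` vertices and `m` edges, whose encoding is in the memory `enc`, the length `k`
of the cycle, and the number `K` of bit positions of a colouring. -/
structure Params where
  n : ℕ
  m : ℕ
  k : ℕ
  K : ℕ
  enc : ℕ → ℕ

namespace Params

variable (p : Params)

/-- The length of the encoding; vertices are renamed to addresses. -/
def N : ℕ := 2 * p.m + 2

/-- The number of bits of an address. -/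
def L : ℕ := Nat.log 2 (2 * p.m + 1) + 1

/-- The number of colourings. -/
def G : ℕ := p.L ^ p.K * 2 ^ (p.k * 2 ^ p.K)

/-- The number of pairs of a colouring and an address. -/
def Z : ℕ := p.G * p.N

/-- The address of the output. -/
def S : ℕ := p.N + p.n

/-- The number of triples of a layer, an edge, and a colouring. -/
def R : ℕ := p.k * p.G * p.m

/-- The last one of the first `N` addresses at which the vertex `v` occurs. -/
def idOf (v : ℕ) : ℕ := Nat.findGreatest (fun a => 2 ≤ a ∧ p.enc a = v) (2 * p.m + 1)

def tail (e : ℕ) : ℕ := p.idOf (p.enc (2 + 2 * e))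

def head (e : ℕ) : ℕ := p.idOf (p.enc (3 + 2 * e))

/-- Whether the edge from `u` to `v` is suitable for layer `i` under the colouring `g`. -/
def ok (i g u v : ℕ) : ℕ :=
  (if col p.L p.k p.K g 0 u = i then 1 else 0) *
    if col p.L p.k p.K g 0 v = (i + 1) % p.k then 1 else 0

def layer (τ : ℕ) : ℕ := τ % p.k

def edge (τ : ℕ) : ℕ := τ / p.k % p.m

def colouring (τ : ℕ) : ℕ := τ / (p.k * p.m)

def tailState (τ : ℕ) : ℕ := p.layer τ * p.Z + p.colouring τ * p.N + p.tail (p.edge τ)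

def headState (τ : ℕ) : ℕ := (p.layer τ + 1) * p.Z + p.colouring τ * p.N + p.head (p.edge τ)

def okAt (τ : ℕ) : ℕ :=
  p.ok (p.layer τ) (p.colouring τ) (p.tail (p.edge τ)) (p.head (p.edge τ))

/-- Cells of the two chain transitions at `z`. -/
def chainCells (z : ℕ) : List ℕ :=
  [z, 2, 0, z + 1, p.k * p.Z + (z + 1), 0, 2, p.k * p.Z + z]

/-- Cells of the transition with index `τ`. -/
def edgeCells (τ : ℕ) : List ℕ := [p.tailState τ, p.okAt τ, p.okAt τ, p.headState τ]

def header : List ℕ :=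
  [(p.k + 1) * p.Z, 2 * (p.Z - 1) + p.R, 0, 0, p.Z, p.k * p.Z, 0, p.Z]

def output : List ℕ :=
  p.header ++ (List.range (p.Z - 1)).flatMap p.chainCells ++
    (List.range p.R).flatMap p.edgeCells

/-- The memory `enc` is the encoding of a graph. -/
structure Valid : Prop where
  zero : p.enc 0 = p.n
  one : p.enc 1 = p.m
  lt : ∀ a, 2 ≤ a → a < p.N → p.enc a < p.n
  out : ∀ a, p.N ≤ a → p.enc a = 0
  k_pos : 1 ≤ p.k

/-- A bound for all the values. -/
def bound : ℕ := p.n + p.N + 8 + 8 * p.Z + 4 * p.R + (p.k + 1) * p.Z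

theorem L_pos : 1 ≤ p.L := by simp [L]

theorem N_pos : 2 ≤ p.N := by simp [N]

theorem L_le_N : p.L ≤ p.N := by
  have := Nat.log_lt_self 2 (x := 2 * p.m + 1) (by omega)
  simp only [L, N]
  omega

theorem G_pos : 1 ≤ p.G :=
  Nat.mul_pos (Nat.pow_pos p.L_pos) (by positivity)

theorem N_le_Z : p.N ≤ p.Z := Nat.le_mul_of_pos_left _ p.G_pos

theorem G_le_Z : p.G ≤ p.Z := Nat.le_mul_of_pos_right _ (by have := p.N_pos; omega)

theorem idOf_lt (v : ℕ) : p.idOf v < p.N := by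
  have : p.idOf v ≤ 2 * p.m + 1 := Nat.findGreatest_le _
  simp only [N]
  omega

theorem colouring_lt {τ : ℕ} (h : τ < p.R) : p.colouring τ < p.G := by
  refine Nat.div_lt_of_lt_mul (h.trans_eq ?_)
  simp only [R]
  ring

theorem slot_lt {g u : ℕ} (hg : g < p.G) (hu : u < p.N) : g * p.N + u < p.Z := by
  have : (g + 1) * p.N ≤ p.G * p.N := Nat.mul_le_mul_right _ hg
  simp only [Z]
  rw [add_mul] at this
  omega

theorem state_lt {i z : ℕ} (hi : i ≤ p.k) (hz : z < p.Z) : i * p.Z + z < (p.k + 1) * p.Z := by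
  have : i * p.Z ≤ p.k * p.Z := Nat.mul_le_mul_right _ hi
  rw [add_mul]
  omega

end Params

/-! #### The program -/

-- Variables `0` to `5` are to hold `n`, `m`, `N`, `L`, `G`, `Z`; variable `6` is the output
-- pointer, `7` and `8` are the loop counter and its limit, and `9` is the output address `S`.
-- Variables from `10` on are temporary.
open WordRAM.Expr in
def setupAssigns : List (ℕ × Expr) :=
  [(0, load (const 0)), (1, load (const 1)),
    (2, bin .add (bin .mul (const 2) (var 1)) (const 2)), (8, bin .mul (const 2) (var 1))]

-- Overwriting keeps the last address at which a vertex occurs, in agreement with `idOf`. Table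
-- entries of vertices that do not occur are never visited, so the cost does not depend on `n`.
open WordRAM.Expr in
def tableBody : Stmt :=
  .seq (.store (bin .add (var 2) (load (bin .add (var 7) (const 2)))) (bin .add (var 7) (const 2)))
    (.assign 7 (bin .add (var 7) (const 1)))

-- The truncated `1 - (1 - y)` is `1` for positive `y` and `0` otherwise, so variable `3` grows
-- until shifting `N - 1` by it gives `0`, and then stays at the bit length `L`.
open WordRAM.Expr in
def bitsAssigns : List (ℕ × Expr) :=
  [(3, bin .add (var 3) (bin .sub (const 1) (bin .sub (const 1)
      (bin .shiftRight (bin .sub (var 2) (const 1)) (var 3))))),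
    (7, bin .add (var 7) (const 1))]

open WordRAM.Expr in
def headerAssigns (k K : ℕ) : List (ℕ × Expr) :=
  [(4, bin .mul (powE (var 3) K) (const (2 ^ (k * 2 ^ K)))), (5, bin .mul (var 4) (var 2)),
    (9, bin .add (var 2) (var 0)), (6, var 9),
    (10, bin .mul (const (k + 1)) (var 5)),
    (11, bin .add (bin .mul (const 2) (bin .sub (var 5) (const 1)))
      (bin .mul (bin .mul (const k) (var 4)) (var 1))),
    (12, const 0), (13, bin .mul (const k) (var 5))]

open WordRAM.Expr in
def chainAssigns (k : ℕ) : List (ℕ × Expr) :=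
  [(11, bin .add (var 7) (const 1)), (12, const 2), (13, const 0),
    (14, bin .add (bin .mul (const k) (var 5)) (var 7)),
    (15, bin .add (bin .mul (const k) (var 5)) (var 11))]

-- Variable `21` is the suitability indicator. Emitted as both update entries, `1` encodes the
-- update `0`, and `0` encodes `-1`. Thus every index yields a transition without branching, and the
-- number of transitions in the header is known in advance.
open WordRAM.Expr in
def edgeAssigns (k K : ℕ) : List (ℕ × Expr) :=
  [(16, bin .mod (var 7) (const k)),
    (17, bin .mod (bin .div (var 7) (const k)) (var 1)),
    (18, bin .div (var 7) (bin .mul (const k) (var 1))),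
    (19, load (bin .add (var 2) (load (bin .add (const 2) (bin .mul (const 2) (var 17)))))),
    (20, load (bin .add (var 2) (load (bin .add (const 3) (bin .mul (const 2) (var 17)))))),
    (21, bin .mul (eqE (colE k K (var 18) (const 0) (var 19)) (var 16))
      (eqE (colE k K (var 18) (const 0) (var 20))
        (bin .mod (bin .add (var 16) (const 1)) (const k)))),
    (22, bin .add (bin .add (bin .mul (var 16) (var 5)) (bin .mul (var 18) (var 2))) (var 19)),
    (23, bin .add (bin .add (bin .mul (bin .add (var 16) (const 1)) (var 5))
      (bin .mul (var 18) (var 2))) (var 20))]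

/-- Add one to the loop variable. -/
def incr : Stmt := .assign 7 (.bin .add (.var 7) (.const 1))

/-- Start a loop of length `e`. -/
def startLoop (e : Expr) : List (ℕ × Expr) := [(7, .const 0), (8, e)]

def chainBody (k : ℕ) : Stmt :=
  .seq (.seq (assigns (chainAssigns k)) (emitAll [7, 12, 13, 11, 15, 13, 12, 14])) incr

def edgeBody (k K : ℕ) : Stmt :=
  .seq (.seq (assigns (edgeAssigns k K)) (emitAll [22, 21, 21, 23])) incr

open WordRAM.Expr in
/-- The whole reduction. -/
def reduction (k K : ℕ) : Stmt :=
  .seq (.seq (assigns setupAssigns) (.loop 7 8 tableBody)) <|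
  .seq (.seq (assigns (startLoop (var 2))) (.loop 7 8 (assigns bitsAssigns))) <|
  .seq (.seq (assigns (headerAssigns k K)) (emitAll [10, 11, 12, 12, 5, 13, 12, 5])) <|
  .seq (.seq (assigns (startLoop (bin .sub (var 5) (const 1)))) (.loop 7 8 (chainBody k))) <|
  .seq (assigns (startLoop (bin .mul (bin .mul (const k) (var 4)) (var 1))))
    (.loop 7 8 (edgeBody k K))

end WordRAM

/-! ### Correctness of the reduction program: vertex table, bit length, header -/

namespace WordRAM

open Function

theorem wp_incr {B T : ℕ} {Q : State → Prop} {s : State} (hs : s.Bdd B) (hB : s.var 7 + 1 ≤ B)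
    (hT : 4 ≤ T) (h : Q (s.set 7 (s.var 7 + 1))) : incr.Wp B T Q s :=
  (Stmt.wp_assign (e := .bin .add (.var 7) (.const 1)) hs hB h).mono hT fun _ h => h

theorem State.run_mem (s : State) (es : List (ℕ × Expr)) : (s.run es).mem = s.mem := by
  induction es generalizing s with
  | nil => rfl
  | cons re es ih => exact ih _

namespace Params

variable {p : Params} {B : ℕ}

/-- After `j` rounds of the first loop: the table of addresses behind the input. -/
structure Tabled (p : Params) (j : ℕ) (s : State) : Prop where
  v0 : s.var 0 = p.n
  v1 : s.var 1 = p.m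
  v2 : s.var 2 = p.N
  v3 : s.var 3 = 0
  v7 : s.var 7 = j
  v8 : s.var 8 = 2 * p.m
  low : ∀ a < p.N, s.mem a = p.enc a
  table : ∀ v < p.n, s.mem (p.N + v) = Nat.findGreatest (fun a => 2 ≤ a ∧ p.enc a = v) (j + 1)
  high : ∀ a, p.S ≤ a → s.mem a = 0

theorem wp_setup (hp : p.Valid) (hB : p.bound ≤ B) {s : State} (hs : s.Bdd B)
    (hvar : ∀ i, s.var i = 0) (hmem : s.mem = p.enc) :
    (assigns setupAssigns).Wp B (assignsCost setupAssigns) (p.Tabled 0) s := by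
  have hN : p.N = 2 * p.m + 2 := rfl
  simp only [bound] at hB
  refine (wp_assigns _ hs ?_).mono le_rfl ?_
  · simp [AllLe, setupAssigns, Expr.eval, Arith.toBinOp, BinOp.eval, State.set, hmem, hp.zero,
      hp.one]
    omega
  · rintro _ rfl
    constructor <;> simp [setupAssigns, State.run, State.set, Expr.eval, Arith.toBinOp, BinOp.eval,
      hmem, hp.zero, hp.one, hvar, N]
    · intro v hv
      exact hp.out _ (by omega)
    · intro a ha
      exact hp.out _ (by simp only [S] at ha; omega)

theorem wp_tableBody (hp : p.Valid) (hB : p.bound ≤ B) {s : State} (hs : s.Bdd B) {j : ℕ}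
    (hj : j < 2 * p.m) (h : p.Tabled j s) : tableBody.Wp B 14 (p.Tabled (j + 1)) s := by
  have hN : p.N = 2 * p.m + 2 := rfl
  simp only [bound] at hB
  have hlt := hp.lt (j + 2) (by omega) (by omega)
  have hl := h.low (j + 2) (by omega)
  refine (Stmt.wp_seq (T := 10) (T' := 4)
    (Q := fun s' => s' = s.poke (p.N + p.enc (j + 2)) (j + 2)) ?_ ?_).mono le_rfl fun _ h => h
  · refine (Stmt.wp_store hs ?_ ?_).mono (T := _) ?_ fun _ h => h
    · simp only [Expr.eval, Arith.toBinOp, BinOp.eval, h.v7]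
      omega
    · simp only [Expr.eval, Arith.toBinOp, BinOp.eval, h.v7, h.v2, hl]
    · simp [Expr.cost]
  · rintro _ hb rfl
    refine wp_incr hb ?_ le_rfl ?_
    · simp only [State.poke, h.v7]
      omega
    · constructor <;> simp only [State.set, State.poke, h.v7, ne_eq, OfNat.zero_ne_ofNat,
        OfNat.one_ne_ofNat, not_false_eq_true, update_of_ne, h.v0, h.v1, h.v2, h.v3, h.v8,
        Nat.reduceEqDiff, update_self]
      · intro a ha
        rw [update_of_ne (by omega), h.low a ha]
      · intro v hv
        rw [Nat.findGreatest_succ]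
        by_cases hv' : p.enc (j + 2) = v
        · rw [if_pos ⟨by omega, hv'⟩, hv', update_self]
        · rw [if_neg fun h => hv' h.2, update_of_ne (by omega), h.table v hv]
      · intro a ha
        rw [update_of_ne (by simp only [S] at ha; omega), h.high a ha]

theorem wp_table (hp : p.Valid) (hB : p.bound ≤ B) {s : State} (hs : s.Bdd B)
    (hvar : ∀ i, s.var i = 0) (hmem : s.mem = p.enc) :
    (Stmt.seq (assigns setupAssigns) (.loop 7 8 tableBody)).Wp B
      (assignsCost setupAssigns + (2 * p.m * (14 + 1) + 1)) (p.Tabled (2 * p.m)) s := by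
  refine Stmt.wp_seq (wp_setup hp hB hs hvar hmem) fun s' hs' h' => ?_
  refine Stmt.wp_loop (2 * p.m) p.Tabled hs' h' (fun l hl s h => ?_) (fun s h => ?_)
    fun l hl s hs h => wp_tableBody hp hB hs hl h
  · rw [h.v7, h.v8]; exact hl
  · rw [h.v7, h.v8]; exact lt_irrefl _

/-- After the computation of the number of bits. -/
structure Measured (p : Params) (s : State) : Prop where
  v0 : s.var 0 = p.n
  v1 : s.var 1 = p.m
  v2 : s.var 2 = p.N
  v3 : s.var 3 = p.L
  low : ∀ a < p.N, s.mem a = p.enc a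
  table : ∀ v < p.n, s.mem (p.N + v) = p.idOf v
  high : ∀ a, p.S ≤ a → s.mem a = 0

/-- During the computation of the number of bits. -/
structure Measuring (p : Params) (j : ℕ) (s : State) : Prop where
  v0 : s.var 0 = p.n
  v1 : s.var 1 = p.m
  v2 : s.var 2 = p.N
  v3 : s.var 3 = min j p.L
  v7 : s.var 7 = j
  v8 : s.var 8 = p.N
  low : ∀ a < p.N, s.mem a = p.enc a
  table : ∀ v < p.n, s.mem (p.N + v) = p.idOf v
  high : ∀ a, p.S ≤ a → s.mem a = 0

theorem wp_bits (hB : p.bound ≤ B) {s : State} (hs : s.Bdd B) (h : p.Tabled (2 * p.m) s) :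
    (Stmt.seq (assigns (startLoop (.var 2))) (.loop 7 8 (assigns bitsAssigns))).Wp B
      (assignsCost (startLoop (.var 2)) + (p.N * (assignsCost bitsAssigns + 1) + 1))
      p.Measured s := by
  have hN : p.N = 2 * p.m + 2 := rfl
  simp only [bound] at hB
  refine Stmt.wp_seq (Q := p.Measuring 0) ((wp_assigns _ hs ?_).mono le_rfl ?_) fun s' hs' h' => ?_
  · simp [AllLe, startLoop, Expr.eval, State.set, h.v2]
    omega
  · rintro _ rfl
    constructor <;> simp [startLoop, State.run, State.set, Expr.eval, h.v0, h.v1, h.v2, h.v3]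
    · exact h.low
    · exact h.table
    · exact h.high
  refine (Stmt.wp_loop p.N p.Measuring hs' h' (fun l hl s h => ?_) (fun s h => ?_)
    fun l hl s hs h => ?_).mono le_rfl fun s h => ?_
  · rw [h.v7, h.v8]; exact hl
  · rw [h.v7, h.v8]; exact lt_irrefl _
  · have hL := p.L_le_N
    have hval : min l p.L + (1 - (1 - ((p.N - 1) >>> min l p.L))) = min (l + 1) p.L := by
      have hN1 : p.N - 1 = 2 * p.m + 1 := by omega
      -- `L` is the number of binary digits of `N - 1`, the largest address of the input.
      have key : ∀ j, (p.N - 1) >>> j = 0 ↔ p.L ≤ j := by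
        intro j
        rw [hN1, Nat.shiftRight_eq_div_pow, Nat.div_eq_zero_iff, L, Nat.add_one_le_iff,
          Nat.log_lt_iff_lt_pow (by omega) (by omega)]
        have : 2 ^ j ≠ 0 := by positivity
        tauto
      rcases lt_or_ge l p.L with h1 | h1
      · have := (key l).not.mpr (by omega)
        rw [min_eq_left h1.le]
        generalize (p.N - 1) >>> l = y at this
        omega
      · have := (key p.L).mpr le_rfl
        rw [min_eq_right h1, this]
        omega
    refine (wp_assigns _ hs ?_).mono le_rfl ?_
    · simp only [AllLe, bitsAssigns, Expr.eval, State.set, h.v2, h.v3, Arith.toBinOp,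
        BinOp.eval, hval]
      simp [h.v7]
      omega
    · rintro _ rfl
      constructor <;> simp [bitsAssigns, State.run, State.set, Expr.eval, h.v0, h.v1, h.v2, h.v3,
        h.v7, h.v8, Arith.toBinOp, BinOp.eval, hval]
      · exact h.low
      · exact h.table
      · exact h.high
  · exact ⟨h.v0, h.v1, h.v2, by rw [h.v3, min_eq_right p.L_le_N], h.low, h.table, h.high⟩

/-- The list `l` has been written. -/
structure Written (p : Params) (l : List ℕ) (s : State) : Prop where
  v1 : s.var 1 = p.m
  v2 : s.var 2 = p.N
  v3 : s.var 3 = p.L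
  v4 : s.var 4 = p.G
  v5 : s.var 5 = p.Z
  v6 : s.var 6 = p.S + l.length
  v9 : s.var 9 = p.S
  low : ∀ a < p.N, s.mem a = p.enc a
  table : ∀ v < p.n, s.mem (p.N + v) = p.idOf v
  holds : Holds s.mem p.S l

/-- Emitting eight cells costs `58 = 7 * 8 + 2` steps. The output starts as the empty list because
memory from `S` on is still zero. -/
theorem wp_header {p : Params} (hB : p.bound ≤ B) {s : State} (hs : s.Bdd B) (h : p.Measured s) :
    (Stmt.seq (assigns (headerAssigns p.k p.K)) (emitAll [10, 11, 12, 12, 5, 13, 12, 5])).Wp B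
      (assignsCost (headerAssigns p.k p.K) + 58) (p.Written p.header) s := by
  have hGZ := p.G_le_Z
  have hNZ := p.N_le_Z
  simp only [bound] at hB
  have hk1 : (p.k + 1) * p.Z = p.k * p.Z + p.Z := by ring
  have hG : p.L ^ p.K * 2 ^ (p.k * 2 ^ p.K) = p.G := rfl
  have hZ : p.G * p.N = p.Z := rfl
  have hR : p.k * p.G * p.m = p.R := rfl
  have hS : p.N + p.n = p.S := rfl
  refine Stmt.wp_seq (wp_assigns _ hs ?_) fun s' hs' h' => ?_
  · simp [AllLe, headerAssigns, Expr.eval, State.set, h.v0, h.v1, h.v2, h.v3, Arith.toBinOp,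
      BinOp.eval, Expr.eval_powE, hG, hZ, hR]
    omega
  have em : s'.mem = s.mem := h' ▸ s.run_mem _
  obtain ⟨e1, e2, e3, e4, e5, e6, e9, e10, e11, e12, e13⟩ : s'.var 1 = p.m ∧ s'.var 2 = p.N ∧
      s'.var 3 = p.L ∧ s'.var 4 = p.G ∧ s'.var 5 = p.Z ∧ s'.var 6 = p.S ∧ s'.var 9 = p.S ∧
      s'.var 10 = (p.k + 1) * p.Z ∧ s'.var 11 = 2 * (p.Z - 1) + p.R ∧ s'.var 12 = 0 ∧
      s'.var 13 = p.k * p.Z := by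
    subst h'
    simp [headerAssigns, State.run, State.set, Expr.eval, h.v0, h.v1, h.v2, h.v3, Arith.toBinOp,
      BinOp.eval, Expr.eval_powE, hG, hZ, hR, hS]
  refine (wp_emitAll (S := p.S) (l := []) _ (by simp) hs' (by simpa using e6) ?_ ?_).mono le_rfl
    fun s'' h'' => ?_
  · intro i
    rw [em, h.high _ (by omega)]
    simp
  · simp
    omega
  · have hhead : [] ++ [10, 11, 12, 12, 5, 13, 12, 5].map s'.var = p.header := by
      simp [e10, e11, e12, e5, e13, header]
    replace h'' : Emitted p.S [] p.header s' s'' := hhead ▸ h''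
    constructor
    · rw [h''.var _ (by omega), e1]
    · rw [h''.var _ (by omega), e2]
    · rw [h''.var _ (by omega), e3]
    · rw [h''.var _ (by omega), e4]
    · rw [h''.var _ (by omega), e5]
    · exact h''.ptr
    · rw [h''.var _ (by omega), e9]
    · intro a ha
      rw [h''.mem _ (by omega), em, h.low a ha]
    · intro v hv
      rw [h''.mem _ (by omega), em, h.table v hv]
    · exact h''.holds

end Params
end WordRAM

/-! ### Correctness of the reduction program: the loops that write the transitions -/

namespace WordRAM

open Function

theorem State.run_var_of_notMem (s : State) (es : List (ℕ × Expr)) {i : ℕ}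
    (h : i ∉ es.map Prod.fst) : (s.run es).var i = s.var i := by
  induction es generalizing s with
  | nil => rfl
  | cons re es ih =>
    rw [List.map_cons, List.mem_cons, not_or] at h
    rw [State.run, ih _ h.2]
    simp [State.set, h.1]

theorem length_flatMap_range (f : ℕ → List ℕ) (c n : ℕ) (h : ∀ i, (f i).length = c) :
    ((List.range n).flatMap f).length = n * c := by
  simp [List.length_flatMap, h]

namespace Params

variable {p : Params} {B : ℕ}

/-- The list `l` has been written, in round `j` of a loop of length `j'`. -/
structure Looping (p : Params) (j' : ℕ) (l : List ℕ) (j : ℕ) (s : State) : Prop extends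
    Written p l s where
  v7 : s.var 7 = j
  v8 : s.var 8 = j'

theorem wp_startLoop {e : Expr} {j' : ℕ} {l : List ℕ} {s : State} (hs : s.Bdd B)
    (h : p.Written l s) (he : e.eval (s.set 7 0) = j') (hB : j' ≤ B) :
    (assigns (startLoop e)).Wp B (assignsCost (startLoop e)) (p.Looping j' l 0) s := by
  refine (wp_assigns _ hs ?_).mono le_rfl ?_
  · simp [AllLe, startLoop, Expr.eval, he, hB]
  · rintro _ rfl
    have hv : ∀ i, i ≠ 7 → i ≠ 8 → (s.run (startLoop e)).var i = s.var i := fun i h7 h8 =>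
      s.run_var_of_notMem _ (by simp [startLoop, h7, h8])
    have hm := s.run_mem (startLoop e)
    refine ⟨⟨?_, ?_, ?_, ?_, ?_, ?_, ?_, ?_, ?_, ?_⟩, ?_, ?_⟩
    · rw [hv _ (by omega) (by omega), h.v1]
    · rw [hv _ (by omega) (by omega), h.v2]
    · rw [hv _ (by omega) (by omega), h.v3]
    · rw [hv _ (by omega) (by omega), h.v4]
    · rw [hv _ (by omega) (by omega), h.v5]
    · rw [hv _ (by omega) (by omega), h.v6]
    · rw [hv _ (by omega) (by omega), h.v9]
    · rw [hm]; exact h.low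
    · rw [hm]; exact h.table
    · rw [hm]; exact h.holds
    · simp [startLoop, State.run, State.set, Expr.eval]
    · simp only [State.set] at he
      simp [startLoop, State.run, State.set, Expr.eval, he]

/-- Common to the chain loop and the edge loop. Assigning only variables from `10` on protects the
parameters, the pointer and the loop counter. -/
theorem wp_emitBody {es : List (ℕ × Expr)} {rs : List ℕ} {l cells : List ℕ} {j j' : ℕ} {s : State}
    (hs : s.Bdd B) (h : p.Looping j' l j s) (hes : ∀ r ∈ es.map Prod.fst, 10 ≤ r) (hrs : 6 ∉ rs)
    (hle : AllLe B s es) (hcells : rs.map (s.run es).var = cells) (hj : j + 1 ≤ B)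
    (hlen : p.S + l.length + rs.length ≤ B) :
    (Stmt.seq (.seq (assigns es) (emitAll rs)) incr).Wp B
      (assignsCost es + (7 * rs.length + 2) + 4) (p.Looping j' (l ++ cells) (j + 1)) s := by
  refine Stmt.wp_seq (Q := Emitted p.S l cells (s.run es))
    (Stmt.wp_seq (wp_assigns es hs hle) ?_) fun s' hs' h' => ?_
  · rintro _ hb rfl
    rw [← hcells]
    refine wp_emitAll rs hrs hb ?_ ?_ hlen
    · rw [s.run_var_of_notMem _ fun h => absurd (hes _ h) (by omega), h.v6]
    · rw [s.run_mem]; exact h.holds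
  · have hv : ∀ i, i < 10 → i ≠ 6 → s'.var i = s.var i := fun i hi h6 => by
      rw [h'.var i h6, s.run_var_of_notMem _ fun h => absurd (hes _ h) (by omega)]
    have h7 : s'.var 7 = j := by rw [hv _ (by omega) (by omega), h.v7]
    have hm : ∀ a < p.S, s'.mem a = s.mem a := fun a ha => by
      rw [h'.mem a ha, s.run_mem]
    refine wp_incr hs' (h7 ▸ hj) le_rfl ⟨⟨?_, ?_, ?_, ?_, ?_, ?_, ?_, ?_, ?_, ?_⟩, ?_, ?_⟩ <;>
      simp only [State.set, ne_eq, Nat.reduceEqDiff, OfNat.one_ne_ofNat, not_false_eq_true,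
        update_of_ne, update_self]
    · rw [hv _ (by omega) (by omega), h.v1]
    · rw [hv _ (by omega) (by omega), h.v2]
    · rw [hv _ (by omega) (by omega), h.v3]
    · rw [hv _ (by omega) (by omega), h.v4]
    · rw [hv _ (by omega) (by omega), h.v5]
    · exact h'.ptr
    · rw [hv _ (by omega) (by omega), h.v9]
    · intro a ha
      rw [hm _ (by simp only [S]; omega), h.low a ha]
    · intro v hv
      rw [hm _ (by simp only [S]; omega), h.table v hv]
    · exact h'.holds
    · rw [h7]
    · rw [hv _ (by omega) (by omega), h.v8]

theorem Looping.loop {l : List ℕ} {j' T : ℕ} {cells : ℕ → List ℕ} {st : Stmt} {s : State}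
    (hs : s.Bdd B) (h : p.Looping j' l 0 s)
    (hst : ∀ j < j', ∀ s, s.Bdd B → p.Looping j' (l ++ (List.range j).flatMap cells) j s →
      st.Wp B T (p.Looping j' ((l ++ (List.range j).flatMap cells) ++ cells j) (j + 1)) s) :
    (Stmt.loop 7 8 st).Wp B (j' * (T + 1) + 1)
      (p.Written (l ++ (List.range j').flatMap cells)) s := by
  refine (Stmt.wp_loop j' (fun j => p.Looping j' (l ++ (List.range j).flatMap cells) j) hs
    (by simpa using h) (fun j hj s h => ?_) (fun s h => ?_) fun j hj s hs h => ?_).mono le_rfl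
    fun s h => h.toWritten
  · rw [h.v7, h.v8]; exact hj
  · rw [h.v7, h.v8]; exact lt_irrefl _
  · refine (hst j hj s hs h).mono le_rfl fun s h => ?_
    simpa [List.range_succ, List.flatMap_append] using h

theorem wp_chain (hB : p.bound ≤ B) {s : State} (hs : s.Bdd B) (h : p.Written p.header s) :
    (Stmt.seq (assigns (startLoop (.bin .sub (.var 5) (.const 1))))
      (.loop 7 8 (chainBody p.k))).Wp B
      (assignsCost (startLoop (.bin .sub (.var 5) (.const 1))) +
        ((p.Z - 1) * (assignsCost (chainAssigns p.k) + 58 + 4 + 1) + 1))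
      (p.Written (p.header ++ (List.range (p.Z - 1)).flatMap p.chainCells)) s := by
  have hS : p.S = p.N + p.n := rfl
  simp only [bound] at hB
  have hk1 : (p.k + 1) * p.Z = p.k * p.Z + p.Z := by ring
  refine Stmt.wp_seq (wp_startLoop hs h (j' := p.Z - 1) ?_ (by omega)) fun s hs h => ?_
  · simp [Expr.eval, Arith.toBinOp, BinOp.eval, State.set, h.v5]
  refine h.loop hs fun j hj s hs h => ?_
  refine wp_emitBody hs h ?_ (by simp) ?_ ?_ (by omega) ?_
  · simp [chainAssigns]
  · simp [AllLe, chainAssigns, Expr.eval, Arith.toBinOp, BinOp.eval, State.set, h.v5, h.v7]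
    omega
  · simp [chainAssigns, State.run, Expr.eval, Arith.toBinOp, BinOp.eval, State.set, h.v5, h.v7,
      chainCells]
  · rw [List.length_append, length_flatMap_range _ 8 _ fun _ => rfl]
    simp [header]
    omega

theorem wp_edges (hp : p.Valid) (hB : p.bound ≤ B) {s : State} (hs : s.Bdd B)
    (h : p.Written (p.header ++ (List.range (p.Z - 1)).flatMap p.chainCells) s) :
    (Stmt.seq (assigns (startLoop (.bin .mul (.bin .mul (.const p.k) (.var 4)) (.var 1))))
      (.loop 7 8 (edgeBody p.k p.K))).Wp B
      (assignsCost (startLoop (.bin .mul (.bin .mul (.const p.k) (.var 4)) (.var 1))) +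
        (p.R * (assignsCost (edgeAssigns p.k p.K) + 30 + 4 + 1) + 1))
      (p.Written p.output) s := by
  have hN : p.N = 2 * p.m + 2 := rfl
  have hS : p.S = p.N + p.n := rfl
  have hNZ := p.N_le_Z
  have hGZ := p.G_le_Z
  have hkp := hp.k_pos
  simp only [bound] at hB
  have hk1 : (p.k + 1) * p.Z = p.k * p.Z + p.Z := by ring
  refine Stmt.wp_seq (wp_startLoop hs h (j' := p.R) ?_ (by omega)) fun s hs h => ?_
  · simp [Expr.eval, Arith.toBinOp, BinOp.eval, State.set, h.v4, h.v1, R]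
  refine h.loop hs fun j hj s hs h => ?_
  have hm : 0 < p.m := by
    rcases Nat.eq_zero_or_pos p.m with h0 | h0
    · simp [R, h0] at hj
    · exact h0
  have hi : j % p.k < p.k := Nat.mod_lt _ hkp
  have he : j / p.k % p.m < p.m := Nat.mod_lt _ hm
  have hg : j / (p.k * p.m) < p.G := p.colouring_lt hj
  have hload : ∀ c, 2 ≤ c → c ≤ 3 → s.mem (p.N + s.mem (c + 2 * (j / p.k % p.m))) =
      p.idOf (p.enc (c + 2 * (j / p.k % p.m))) := by
    intro c hc hc'
    rw [h.low (c + 2 * (j / p.k % p.m)) (by omega), h.table _ (hp.lt _ (by omega) (by omega))]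
  have htail := hload 2 le_rfl (by omega)
  have hhead := hload 3 (by omega) le_rfl
  have hslot := fun v => p.slot_lt hg (p.idOf_lt v)
  have hts := p.state_lt hi.le (hslot (p.enc (2 + 2 * (j / p.k % p.m))))
  have hhs := p.state_lt (i := j % p.k + 1) hi (hslot (p.enc (3 + 2 * (j / p.k % p.m))))
  have hid := p.idOf_lt
  have hid2 := hid (p.enc (2 + 2 * (j / p.k % p.m)))
  have hid3 := hid (p.enc (3 + 2 * (j / p.k % p.m)))
  have hjk : j / p.k ≤ j := Nat.div_le_self _ _
  have hjk' : j % p.k ≤ j := Nat.mod_le _ _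
  refine wp_emitBody hs h ?_ (by simp) ?_ ?_ (by omega) ?_
  · simp [edgeAssigns]
  · simp only [AllLe, edgeAssigns, Expr.eval, Expr.eval_eqE, Expr.eval_colE, Arith.toBinOp,
      BinOp.eval, State.set, and_true]
    simp [h.v1, h.v2, h.v3, h.v5, h.v7, htail, hhead]
    refine ⟨by omega, by omega, by omega, by omega, by omega, ?_, by omega, by omega⟩
    split
    · split <;> omega
    · omega
  · simp only [State.run, edgeAssigns, Expr.eval, Expr.eval_eqE, Expr.eval_colE, Arith.toBinOp,
      BinOp.eval, State.set]
    simp [h.v1, h.v2, h.v3, h.v5, h.v7, htail, hhead, edgeCells, tailState, headState, okAt, ok,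
      layer, edge, colouring, tail, head]
    rfl
  · rw [List.length_append, List.length_append, length_flatMap_range _ 8 _ fun _ => rfl,
      length_flatMap_range _ 4 _ fun _ => rfl]
    simp [header]
    omega

/-- The constant depends on `k` and `K` alone. Every loop makes at most `Z + R` rounds, since `2 * m
≤ N ≤ Z`, and each round has constant cost. -/
theorem wp_reduction (k K : ℕ) : ∃ c, ∀ (p : Params) (B : ℕ), p.k = k → p.K = K → p.Valid →
    p.bound ≤ B → ∀ s : State, s.Bdd B → (∀ i, s.var i = 0) → s.mem = p.enc →
    (reduction k K).Wp B (c * (p.Z + p.R)) (fun s => ∀ i, s.mem (s.var 9 + i) =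
      p.output.getD i 0) s := by
  refine ⟨assignsCost setupAssigns + 16 + (assignsCost (startLoop (.var 2)) +
    (assignsCost bitsAssigns + 2)) + (assignsCost (headerAssigns k K) + 58) +
    (assignsCost (startLoop (.bin .sub (.var 5) (.const 1))) +
      (assignsCost (chainAssigns k) + 58 + 4 + 2)) +
    (assignsCost (startLoop (.bin .mul (.bin .mul (.const k) (.var 4)) (.var 1))) +
      (assignsCost (edgeAssigns k K) + 30 + 4 + 2)), ?_⟩
  rintro p B rfl rfl hp hB s hs hvar hmem
  refine (Stmt.wp_seq (wp_table hp hB hs hvar hmem) fun s hs h =>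
    Stmt.wp_seq (wp_bits hB hs h) fun s hs h =>
    Stmt.wp_seq (wp_header hB hs h) fun s hs h =>
    Stmt.wp_seq (wp_chain hB hs h) fun s hs h =>
    wp_edges hp hB hs h).mono ?_ fun s h => ?_
  · have hN : p.N = 2 * p.m + 2 := rfl
    have hNZ := p.N_le_Z
    obtain ⟨d, hd⟩ : ∃ d, p.Z + p.R = d := ⟨_, rfl⟩
    have h1 : ∀ x a, a ≤ d → a * (x + 1) + 1 ≤ (x + 2) * d := by
      intro x a ha
      nlinarith [Nat.mul_le_mul_right (x + 1) ha]
    have h2 : ∀ x, x ≤ x * d := fun x => Nat.le_mul_of_pos_right _ (by omega)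
    rw [hd]
    generalize assignsCost setupAssigns = a1
    generalize assignsCost (startLoop (.var 2)) = a2
    generalize assignsCost bitsAssigns = b2
    generalize assignsCost (headerAssigns p.k p.K) = a3
    generalize assignsCost (startLoop (.bin .sub (.var 5) (.const 1))) = a4
    generalize assignsCost (chainAssigns p.k) = b4
    generalize assignsCost (startLoop _) = a5
    generalize assignsCost (edgeAssigns p.k p.K) = b5
    have e1 := h1 14 (2 * p.m) (by omega)
    have e2 := h1 b2 p.N (by omega)
    have e4 := h1 (b4 + 58 + 4) (p.Z - 1) (by omega)
    have e5 := h1 (b5 + 30 + 4) p.R (by omega)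
    generalize p.Z - 1 = z at *
    linarith [h2 a1, h2 a2, h2 a3, h2 a4, h2 a5, h2 58]
  · rw [h.v9]
    exact h.holds

end Params
end WordRAM

/-! ### The coverability instance -/

namespace WordRAM

namespace Params

variable (p : Params)

/-- Different edges have different pairs of end points. -/
def Simple : Prop :=
  ∀ e < p.m, ∀ e' < p.m, p.tail e = p.tail e' → p.head e = p.head e' → e = e'

theorem card_pos : 0 < (p.k + 1) * p.Z :=
  Nat.mul_pos (by omega) (by have := p.N_pos; have := p.N_le_Z; omega)

instance : NeZero ((p.k + 1) * p.Z) := ⟨p.card_pos.ne'⟩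

/-- The state with number `a`. -/
def st (a : ℕ) : Fin ((p.k + 1) * p.Z) := Fin.ofNat _ a

/-- Transitions between the states of the coverability instance. -/
abbrev Tr : Type := Fin ((p.k + 1) * p.Z) × (Fin 2 → ℤ) × Fin ((p.k + 1) * p.Z)

/-- The two chains preserve the sum of the counters: the first counter moves together with the slot,
and the second one is its complement. -/
def up (z : ℕ) : p.Tr := (p.st z, ![1, -1], p.st (z + 1))

def down (z : ℕ) : p.Tr := (p.st (p.k * p.Z + (z + 1)), ![-1, 1], p.st (p.k * p.Z + z))

/-- A suitable edge leaves the counters alone. An unsuitable one lowers their sum by `2`, and no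
transition ever raises the sum again. -/
def cross (τ : ℕ) : p.Tr :=
  (p.st (p.tailState τ), ![(p.okAt τ : ℤ) - 1, (p.okAt τ : ℤ) - 1], p.st (p.headState τ))

def transitions : List p.Tr :=
  (List.range (p.Z - 1)).flatMap (fun z => [p.up z, p.down z]) ++ (List.range p.R).map p.cross

theorem mem_transitions {t : p.Tr} : t ∈ p.transitions ↔
    (∃ z, z < p.Z - 1 ∧ (t = p.up z ∨ t = p.down z)) ∨ ∃ τ, τ < p.R ∧ t = p.cross τ := by
  simp [transitions, eq_comm]

theorem okAt_eq (τ : ℕ) : p.okAt τ = 0 ∨ p.okAt τ = 1 := by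
  simp only [okAt, ok]
  split <;> split <;> simp

theorem two_le_Z : 2 ≤ p.Z := p.N_pos.trans p.N_le_Z

/-- The position of the tail of an edge within its layer. -/
def tailSlot (τ : ℕ) : ℕ := p.colouring τ * p.N + p.tail (p.edge τ)

def headSlot (τ : ℕ) : ℕ := p.colouring τ * p.N + p.head (p.edge τ)

theorem tailState_eq (τ : ℕ) : p.tailState τ = p.layer τ * p.Z + p.tailSlot τ := add_assoc _ _ _

theorem headState_eq (τ : ℕ) : p.headState τ = (p.layer τ + 1) * p.Z + p.headSlot τ :=
  add_assoc _ _ _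

variable {p}

theorem tailSlot_lt {τ : ℕ} (h : τ < p.R) : p.tailSlot τ < p.Z :=
  p.slot_lt (p.colouring_lt h) (p.idOf_lt _)

theorem headSlot_lt {τ : ℕ} (h : τ < p.R) : p.headSlot τ < p.Z :=
  p.slot_lt (p.colouring_lt h) (p.idOf_lt _)

theorem layer_lt (hp : p.Valid) (τ : ℕ) : p.layer τ < p.k := Nat.mod_lt _ hp.k_pos

theorem st_val {a : ℕ} (h : a < (p.k + 1) * p.Z) : (p.st a).val = a := Nat.mod_eq_of_lt h

theorem add_inj_of_lt {Z i i' z z' : ℕ} (hz : z < Z) (hz' : z' < Z)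
    (h : i * Z + z = i' * Z + z') : i = i' ∧ z = z' := by
  have h1 : (i * Z + z) / Z = i := by
    rw [mul_comm, Nat.mul_add_div (by omega), Nat.div_eq_of_lt hz, add_zero]
  have h2 : (i' * Z + z') / Z = i' := by
    rw [mul_comm, Nat.mul_add_div (by omega), Nat.div_eq_of_lt hz', add_zero]
  have hi : i = i' := by rw [← h1, h, h2]
  subst hi
  exact ⟨rfl, by omega⟩

theorem tailState_lt (hp : p.Valid) {τ : ℕ} (h : τ < p.R) :
    p.tailState τ < (p.k + 1) * p.Z := by
  rw [tailState_eq]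
  exact p.state_lt (layer_lt hp τ).le (tailSlot_lt h)

theorem headState_lt (hp : p.Valid) {τ : ℕ} (h : τ < p.R) :
    p.headState τ < (p.k + 1) * p.Z := by
  rw [headState_eq]
  exact p.state_lt (layer_lt hp τ) (headSlot_lt h)

theorem edge_lt {τ : ℕ} (h : τ < p.R) : p.edge τ < p.m := by
  refine Nat.mod_lt _ (Nat.pos_of_ne_zero fun h0 => ?_)
  simp [R, h0] at h

theorem index_eq (τ : ℕ) : τ = p.layer τ + p.k * (p.edge τ + p.m * p.colouring τ) := by
  have h1 := Nat.mod_add_div τ p.k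
  have h2 := Nat.mod_add_div (τ / p.k) p.m
  rw [Nat.div_div_eq_div_mul] at h2
  simp only [layer, edge, colouring, h2, h1]

/-- The tail state determines layer, colouring and tail, the head state determines the head, and in
a simple graph tail and head determine the edge. These three coordinates recover the index by
`index_eq`. -/
theorem cross_injOn (hp : p.Valid) (hs : p.Simple) {τ τ' : ℕ} (h : τ < p.R) (h' : τ' < p.R)
    (heq : p.cross τ = p.cross τ') : τ = τ' := by
  simp only [cross, Prod.mk.injEq] at heq
  have ht := congrArg Fin.val heq.1
  have hh := congrArg Fin.val heq.2.2
  rw [st_val (tailState_lt hp h), st_val (tailState_lt hp h'), tailState_eq, tailState_eq] at ht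
  rw [st_val (headState_lt hp h), st_val (headState_lt hp h'), headState_eq, headState_eq] at hh
  obtain ⟨hl, ht⟩ := add_inj_of_lt (tailSlot_lt h) (tailSlot_lt h') ht
  obtain ⟨-, hh⟩ := add_inj_of_lt (headSlot_lt h) (headSlot_lt h') hh
  obtain ⟨hc, ht⟩ := add_inj_of_lt (p.idOf_lt _) (p.idOf_lt _) ht
  obtain ⟨-, hh⟩ := add_inj_of_lt (p.idOf_lt _) (p.idOf_lt _) hh
  have he := hs _ (edge_lt h) _ (edge_lt h') ht hh
  rw [index_eq (p := p) τ, index_eq (p := p) τ', hl, hc, he]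

theorem row_lt {z : ℕ} (hz : z < p.Z) : z < (p.k + 1) * p.Z := by
  have := p.state_lt (Nat.zero_le _) hz
  rwa [zero_mul, zero_add] at this

theorem nodup_transitions (hp : p.Valid) (hs : p.Simple) : p.transitions.Nodup := by
  refine List.Nodup.append ?_ ?_ ?_
  · rw [List.nodup_flatMap]
    constructor
    · intro z _
      simp [up, down]
    · refine (List.nodup_range (n := p.Z - 1)).pairwise_of_forall_ne fun z hz z' hz' hne => ?_
      rw [List.mem_range] at hz hz'
      have h1 := st_val (p.row_lt (z := z) (by omega))
      have h2 := st_val (p.row_lt (z := z') (by omega))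
      have h3 := st_val (p.state_lt (i := p.k) le_rfl (z := z) (by omega))
      have h4 := st_val (p.state_lt (i := p.k) le_rfl (z := z') (by omega))
      have hup : p.st z' ≠ p.st z := fun h => hne (by rw [h] at h2; omega)
      have hdown : p.st (p.k * p.Z + z') ≠ p.st (p.k * p.Z + z) := fun h =>
        hne (by rw [h] at h4; omega)
      simp [Function.onFun, up, down, hup, hdown]
  · exact List.nodup_range.map_on fun τ h τ' h' heq =>
      cross_injOn hp hs (List.mem_range.1 h) (List.mem_range.1 h') heq
  · intro t ht ht'
    obtain ⟨z, -, hz⟩ := List.mem_flatMap.1 ht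
    obtain ⟨τ, -, rfl⟩ := List.mem_map.1 ht'
    -- Edge transitions change both counters equally, chain transitions in opposite directions.
    have hx : (p.cross τ).2.1 0 = (p.cross τ).2.1 1 := rfl
    rcases List.mem_pair.1 hz with h | h <;> rw [h] at hx <;> simp [up, down] at hx

/-- The coverability instance for a graph. -/
def coverInput (hp : p.Valid) (hs : p.Simple) : UnaryCoverInput 2 where
  q := (p.k + 1) * p.Z
  V :=
    { T := p.transitions.toFinset
      nonempty := ⟨p.up 0, by
        rw [List.mem_toFinset, mem_transitions]
        have := p.two_le_Z
        exact .inl ⟨0, by omega, .inl rfl⟩⟩ }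
  unary := by
    intro t ht i
    rw [List.mem_toFinset, mem_transitions] at ht
    rcases ht with ⟨z, -, rfl | rfl⟩ | ⟨τ, -, rfl⟩
    · fin_cases i <;> simp [up]
    · fin_cases i <;> simp [down]
    · rcases p.okAt_eq τ with h | h <;> fin_cases i <;> simp [cross, h]
  transitions := p.transitions
  nodup := nodup_transitions hp hs
  mem_transitions := fun t => List.mem_toFinset.symm
  source := (p.st 0, ![0, p.Z])
  target := (p.st (p.k * p.Z), ![0, p.Z])

theorem length_transitions : p.transitions.length = 2 * (p.Z - 1) + p.R := by
  simp [transitions, List.length_flatMap, mul_comm]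

theorem encode_coverInput (hp : p.Valid) (hs : p.Simple) :
    (coverInput hp hs).encode = p.output := by
  have hZ := p.two_le_Z
  have h0 : (p.st 0).val = 0 := st_val p.card_pos
  have hk : (p.st (p.k * p.Z)).val = p.k * p.Z :=
    st_val (p.state_lt (i := p.k) le_rfl (z := 0) (by omega))
  have hheader : [(p.k + 1) * p.Z, p.transitions.length] ++
      UnaryCoverInput.encodeConfig (p.st 0, ![0, p.Z]) ++
      UnaryCoverInput.encodeConfig (p.st (p.k * p.Z), ![0, p.Z]) = p.header := by
    simp [UnaryCoverInput.encodeConfig, header, h0, hk, length_transitions]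
  have hchain : ((List.range (p.Z - 1)).flatMap fun z => [p.up z, p.down z]).flatMap
      UnaryCoverInput.encodeTransition = (List.range (p.Z - 1)).flatMap p.chainCells := by
    rw [List.flatMap_assoc]
    refine List.flatMap_congr fun z hz => ?_
    rw [List.mem_range] at hz
    have h1 := st_val (p.row_lt (z := z) (by omega))
    have h2 := st_val (p.row_lt (z := z + 1) (by omega))
    have h3 := st_val (p.state_lt (i := p.k) le_rfl (z := z) (by omega))
    have h4 := st_val (p.state_lt (i := p.k) le_rfl (z := z + 1) (by omega))
    simp [UnaryCoverInput.encodeTransition, up, down, chainCells, h1, h2, h3, h4]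
  have hcross : ((List.range p.R).map p.cross).flatMap UnaryCoverInput.encodeTransition =
      (List.range p.R).flatMap p.edgeCells := by
    rw [List.flatMap_map]
    refine List.flatMap_congr fun τ hτ => ?_
    rw [List.mem_range] at hτ
    have h1 := st_val (tailState_lt hp hτ)
    have h2 := st_val (headState_lt hp hτ)
    simp [UnaryCoverInput.encodeTransition, cross, edgeCells, h1, h2]
  show _ ++ _ ++ _ ++ p.transitions.flatMap UnaryCoverInput.encodeTransition = _
  rw [transitions, List.flatMap_append, hchain, hcross, output, ← hheader, List.append_assoc]
  rfl

theorem size_coverInput (hp : p.Valid) (hs : p.Simple) :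
    (coverInput hp hs).size = (p.k + 1) * p.Z + (2 * (p.Z - 1) + p.R) + p.Z + p.Z := by
  have hZ := p.two_le_Z
  have hn : vecNorm (fun i : Fin 2 => ((![0, p.Z] i : ℕ) : ℤ)) = p.Z := by
    have : (Finset.univ : Finset (Fin 2)) = {0, 1} := rfl
    simp [vecNorm, this]
    omega
  simp only [UnaryCoverInput.size, (coverInput hp hs).unary.size_eq]
  have hcard : (coverInput hp hs).V.T.card = 2 * (p.Z - 1) + p.R := by
    rw [← length_transitions]
    exact List.toFinset_card_of_nodup (nodup_transitions hp hs)
  rw [hcard, Fintype.card_fin]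
  show _ + _ + vecNorm (fun i : Fin 2 => ((![0, p.Z] i : ℕ) : ℤ)) +
    vecNorm (fun i : Fin 2 => ((![0, p.Z] i : ℕ) : ℤ)) = _
  rw [hn]
  rfl

/-! ### Correctness of the coverability instance -/

/-- There is a suitable edge between two positions of adjacent layers. -/
def EdgeAt (p : Params) (i a b : ℕ) : Prop :=
  ∃ τ < p.R, p.layer τ = i ∧ p.tailSlot τ = a ∧ p.headSlot τ = b ∧ p.okAt τ = 1

/-- There is a walk from the first layer to layer `i`. -/
def WalkTo (p : Params) : ℕ → ℕ → ℕ → Prop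
  | 0, a, b => a = b
  | i + 1, a, b => ∃ c, p.WalkTo i a c ∧ p.EdgeAt i c b

/-- The configuration is on a walk, on the way up before it, or on the way down behind it. -/
def OnTrack (p : Params) (c : Fin ((p.k + 1) * p.Z) × (Fin 2 → ℕ)) : Prop :=
  ∃ i z a z', i ≤ p.k ∧ z < p.Z ∧ a < p.Z ∧ c.1.val = i * p.Z + z ∧ p.WalkTo i a z' ∧
    (i < p.k → z = z' ∧ c.2 0 = a) ∧ (i = p.k → c.2 0 + z' = a + z)

/-- What is true for all the configurations that can be reached. -/
def Invariant (p : Params) (c : Fin ((p.k + 1) * p.Z) × (Fin 2 → ℕ)) : Prop :=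
  c.2 0 + c.2 1 ≤ p.Z ∧ (c.2 0 + c.2 1 = p.Z → p.OnTrack c)

/-- The sum never increases, so a configuration with sum `Z` comes from one with sum `Z`, to which
the tracking information applies. Chain steps change the first counter and the slot by the same
amount, and edge steps extend the walk. -/
theorem invariant_step (hp : p.Valid) (hs : p.Simple)
    {c c' : Fin ((p.k + 1) * p.Z) × (Fin 2 → ℕ)} (h : p.Invariant c)
    (hstep : (coverInput hp hs).V.Step c c') : p.Invariant c' := by
  obtain ⟨x, hT, hx⟩ := hstep
  obtain ⟨s, v⟩ := c
  obtain ⟨s', v'⟩ := c'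
  have hx0 := hx 0
  have hx1 := hx 1
  have hkp := hp.k_pos
  have hZ := p.two_le_Z
  obtain ⟨hle, hinv⟩ := h
  simp only at hx0 hx1 hle hinv hT
  replace hT : (s, x, s') ∈ p.transitions := List.mem_toFinset.1 hT
  rw [mem_transitions] at hT
  rcases hT with ⟨z0, hz0, h | h⟩ | ⟨τ, hτ, h⟩
  · simp only [up, Prod.mk.injEq] at h
    obtain ⟨rfl, rfl, rfl⟩ := h
    simp at hx0 hx1
    refine ⟨by simp only; omega, fun hsum => ?_⟩
    simp only at hsum
    obtain ⟨i, z, a, z', hi, hz, ha, hval, hw, h1, h2⟩ := hinv (by omega)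
    simp only at hval h1 h2
    rw [st_val (row_lt (by omega))] at hval
    obtain ⟨hi0, hzz⟩ := add_inj_of_lt (i := 0) (i' := i) (z := z0) (by omega) hz (by omega)
    subst hi0 hzz
    obtain ⟨h3, h4⟩ := h1 (by omega)
    have hw' : a = z' := hw
    -- In layer `0` the walk is still empty, so its start moves along with the slot.
    refine ⟨0, z0 + 1, z0 + 1, z0 + 1, by omega, by omega, by omega, ?_, rfl, fun _ => ⟨rfl, ?_⟩,
      by omega⟩
    · rw [st_val (row_lt (by omega))]
      ring
    · simp only; omega
  · simp only [down, Prod.mk.injEq] at h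
    obtain ⟨rfl, rfl, rfl⟩ := h
    simp at hx0 hx1
    refine ⟨by simp only; omega, fun hsum => ?_⟩
    simp only at hsum
    obtain ⟨i, z, a, z', hi, hz, ha, hval, hw, h1, h2⟩ := hinv (by omega)
    simp only at hval h1 h2
    rw [st_val (p.state_lt le_rfl (by omega))] at hval
    obtain ⟨hi0, hzz⟩ := add_inj_of_lt (by omega) hz hval
    subst hi0 hzz
    have h3 := h2 rfl
    refine ⟨p.k, z0, a, z', le_rfl, by omega, ha, ?_, hw, by omega, ?_⟩
    · exact st_val (p.state_lt le_rfl (by omega))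
    · simp only; omega
  · simp only [cross, Prod.mk.injEq] at h
    obtain ⟨rfl, rfl, rfl⟩ := h
    rcases p.okAt_eq τ with hok | hok
    · simp [hok] at hx0 hx1
      refine ⟨by simp only; omega, fun hsum => ?_⟩
      simp only at hsum
      omega
    · simp [hok] at hx0 hx1
      refine ⟨by simp only; omega, fun hsum => ?_⟩
      simp only at hsum
      obtain ⟨i, z, a, z', hi, hz, ha, hval, hw, h1, h2⟩ := hinv (by omega)
      simp only at hval h1 h2
      rw [st_val (tailState_lt hp hτ), tailState_eq] at hval
      obtain ⟨hi0, hzz⟩ := add_inj_of_lt (tailSlot_lt hτ) hz hval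
      have hlt := layer_lt hp τ
      obtain ⟨h3, h4⟩ := h1 (by omega)
      refine ⟨i + 1, p.headSlot τ, a, p.headSlot τ, by omega, headSlot_lt hτ, ha, ?_,
        ⟨z', hw, τ, hτ, hi0, by omega, rfl, hok⟩, fun _ => ⟨rfl, ?_⟩, fun _ => ?_⟩
      · rw [st_val (headState_lt hp hτ), headState_eq, hi0]
      · simp only; omega
      · simp only; omega

theorem step_of_mem (hp : p.Valid) (hs : p.Simple) {t : p.Tr} (ht : t ∈ p.transitions)
    {x y x' y' : ℕ} (h0 : t.2.1 0 = (x' : ℤ) - x) (h1 : t.2.1 1 = (y' : ℤ) - y) :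
    (coverInput hp hs).V.Step (t.1, ![x, y]) (t.2.2, ![x', y']) := by
  refine ⟨t.2.1, List.mem_toFinset.2 ht, fun i => ?_⟩
  fin_cases i
  · exact h0
  · exact h1

theorem covers_coverInput (hp : p.Valid) (hs : p.Simple) :
    (coverInput hp hs).V.Covers (coverInput hp hs).source (coverInput hp hs).target ↔
      ∃ a < p.Z, p.WalkTo p.k a a := by
  have hkp := hp.k_pos
  have hZ := p.two_le_Z
  have hsrc : (coverInput hp hs).source = (p.st 0, ![0, p.Z]) := rfl
  have htgt : (coverInput hp hs).target = (p.st (p.k * p.Z), ![0, p.Z]) := rfl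
  rw [hsrc, htgt]
  constructor
  · rintro ⟨v, hv, hreach⟩
    have hinv : p.Invariant (p.st (p.k * p.Z), v) := by
      refine Relation.ReflTransGen.rec (motive := fun c _ => p.Invariant c) ?_ ?_ hreach
      · refine ⟨by simp, fun _ => ⟨0, 0, 0, 0, by omega, by omega, by omega, ?_, rfl,
          fun _ => ⟨rfl, rfl⟩, fun _ => by simp⟩⟩
        rw [st_val p.card_pos]
        ring
      · intro c c' _ hstep ih
        exact invariant_step hp hs ih hstep
    -- As the sum is at most `Z`, this forces the first counter to be `0` and the sum to be `Z`. At
    -- slot `0` of the last layer the tracking equation then equates the two ends of the walk.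
    have hv1 : p.Z ≤ v 1 := hv 1
    obtain ⟨hle, hinv⟩ := hinv
    simp only at hle hinv
    obtain ⟨i, z, a, z', hi, hz, ha, hval, hw, h1, h2⟩ := hinv (by omega)
    simp only at hval h1 h2
    have hk := st_val (p.state_lt (i := p.k) le_rfl (z := 0) (by omega))
    rw [add_zero] at hk
    rw [hk] at hval
    obtain ⟨hi0, hzz⟩ := add_inj_of_lt (z := 0) (by omega) hz hval
    subst hi0 hzz
    have h3 := h2 rfl
    obtain rfl : z' = a := by omega
    exact ⟨z', ha, hw⟩
  · rintro ⟨a, ha, hw⟩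
    have hup : ∀ z ≤ a, (coverInput hp hs).V.Reach (p.st 0, ![0, p.Z]) (p.st z, ![z, p.Z - z]) := by
      intro z
      induction z with
      | zero => intro _; exact .refl
      | succ z ih =>
        intro hz
        refine (ih (by omega)).tail (step_of_mem hp hs (t := p.up z) ?_ ?_ ?_)
        · exact p.mem_transitions.2 (.inl ⟨z, by omega, .inl rfl⟩)
        · simp [up]
        · simp only [up, Matrix.cons_val_one, Matrix.cons_val_fin_one]
          omega
    have hwalk : ∀ i ≤ p.k, ∀ b, p.WalkTo i a b → (coverInput hp hs).V.Reach (p.st 0, ![0, p.Z])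
        (p.st (i * p.Z + b), ![a, p.Z - a]) := by
      intro i
      induction i with
      | zero =>
        rintro _ b rfl
        simpa using hup a le_rfl
      | succ i ih =>
        rintro hi b ⟨c, hc, τ, hτ, rfl, rfl, rfl, hok⟩
        have := ih (by omega) _ hc
        rw [← tailState_eq] at this
        rw [← headState_eq]
        refine this.tail (step_of_mem hp hs (t := p.cross τ) ?_ ?_ ?_)
        · exact p.mem_transitions.2 (.inr ⟨τ, hτ, rfl⟩)
        · simp [cross, hok]
        · simp [cross, hok]
    have hdown : ∀ z ≤ a, (coverInput hp hs).V.Reach (p.st (p.k * p.Z + z), ![z, p.Z - z])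
        (p.st (p.k * p.Z), ![0, p.Z]) := by
      intro z
      induction z with
      | zero => intro _; exact .refl
      | succ z ih =>
        intro hz
        refine .head (step_of_mem hp hs (t := p.down z) ?_ ?_ ?_) (ih (by omega))
        · exact p.mem_transitions.2 (.inl ⟨z, by omega, .inr rfl⟩)
        · simp [down]
        · simp only [down, Matrix.cons_val_one, Matrix.cons_val_fin_one]
          omega
    exact ⟨_, le_rfl, (hwalk p.k le_rfl a hw).trans (hdown a le_rfl)⟩

end Params
end WordRAM

/-! ### Colour coding -/

namespace WordRAM

/-- The number whose binary digits are those of `p`, followed by the bits of `v` at the positions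
in the list. -/
def pattern : List ℕ → ℕ → ℕ → ℕ
  | [], p, _ => p
  | b :: l, p, v => pattern l (2 * p + (v >>> b) % 2) v

theorem pattern_lt (l : List ℕ) (p v : ℕ) : pattern l p v < 2 ^ l.length * (p + 1) := by
  induction l generalizing p with
  | nil => simp [pattern]
  | cons b l ih =>
    refine (ih _).trans_le ?_
    rw [List.length_cons, pow_succ, mul_assoc]
    exact Nat.mul_le_mul_left _ (by omega)

/-- The last bit read is the parity of the accumulator, so the bits can be peeled off again. -/
theorem pattern_inj (l : List ℕ) {p p' v v' : ℕ} (h : pattern l p v = pattern l p' v') :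
    p = p' ∧ ∀ b ∈ l, (v >>> b) % 2 = (v' >>> b) % 2 := by
  induction l generalizing p p' with
  | nil => exact ⟨h, by simp⟩
  | cons b l ih =>
    obtain ⟨h1, h2⟩ := ih h
    refine ⟨by omega, fun c hc => ?_⟩
    rcases List.mem_cons.1 hc with rfl | hc
    · omega
    · exact h2 c hc

/-- The positions are the base `L` digits of `g`, lowest first; the part `g'` above them stays free
for the colour table. -/
theorem exists_digits (L k : ℕ) (l : List ℕ) (hl : ∀ b ∈ l, b < L) :
    ∃ g < L ^ l.length, ∀ g' p v, col L k l.length (g + L ^ l.length * g') p v =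
      (g' >>> (k * pattern l p v)) % 2 ^ k := by
  induction l with
  | nil => exact ⟨0, by simp, fun g' p v => by simp [col, pattern]⟩
  | cons b l ih =>
    obtain ⟨g, hg, h⟩ := ih fun c hc => hl c (List.mem_cons_of_mem _ hc)
    have hb : b < L := hl b List.mem_cons_self
    refine ⟨b + L * g, ?_, fun g' p v => ?_⟩
    · rw [List.length_cons, pow_succ']
      have : L * (g + 1) ≤ L * L ^ l.length := Nat.mul_le_mul_left _ hg
      rw [mul_add] at this
      omega
    · have heq : b + L * g + L ^ (l.length + 1) * g' = b + L * (g + L ^ l.length * g') := by ring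
      rw [List.length_cons, heq, col, pattern, Nat.add_mul_mod_self_left, Nat.mod_eq_of_lt hb,
        Nat.add_mul_div_left _ _ (by omega), Nat.div_eq_of_lt hb, zero_add, h]

/-- The table is a number in base `2 ^ k`, with entry `t` as its digit `t`. -/
theorem exists_table (k : ℕ) (T : ℕ) (f : ℕ → ℕ) (hf : ∀ t, f t < 2 ^ k) :
    ∃ g < 2 ^ (k * T), ∀ t < T, (g >>> (k * t)) % 2 ^ k = f t := by
  induction T generalizing f with
  | zero => exact ⟨0, by simp, by simp⟩
  | succ T ih =>
    obtain ⟨g, hg, h⟩ := ih (fun t => f (t + 1)) fun t => hf _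
    refine ⟨f 0 + 2 ^ k * g, ?_, fun t ht => ?_⟩
    · rw [mul_add, mul_one, add_comm (k * T), pow_add]
      have : 2 ^ k * (g + 1) ≤ 2 ^ k * 2 ^ (k * T) := Nat.mul_le_mul_left _ hg
      have := hf 0
      rw [mul_add] at *
      omega
    · cases t with
      | zero => simp [Nat.mod_eq_of_lt (hf 0)]
      | succ t =>
        rw [← h t (by omega), mul_add, mul_one, add_comm (k * t), Nat.shiftRight_add,
          Nat.shiftRight_eq_div_pow _ k, Nat.add_mul_div_left _ _ (by positivity),
          Nat.div_eq_of_lt (hf 0), zero_add]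

theorem exists_bit_ne {v v' L : ℕ} (h : v ≠ v') (hv : v < 2 ^ L) (hv' : v' < 2 ^ L) :
    ∃ b < L, (v >>> b) % 2 ≠ (v' >>> b) % 2 := by
  by_contra! hb
  refine h (Nat.eq_of_testBit_eq fun b => ?_)
  rcases lt_or_ge b L with hlt | hge
  · have := hb b hlt
    simp only [Nat.testBit_eq_decide_div_mod_eq, ← Nat.shiftRight_eq_div_pow, this]
  · have h2 : 2 ^ L ≤ 2 ^ b := Nat.pow_le_pow_right (by omega) hge
    rw [Nat.testBit_lt_two_pow (hv.trans_le h2), Nat.testBit_lt_two_pow (hv'.trans_le h2)]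

/-- Some colouring gives prescribed colours to `k` numbers. -/
theorem exists_colouring {L k : ℕ} (hL : 1 ≤ L) (w : ℕ → ℕ) (hw : ∀ i < k, w i < 2 ^ L)
    (hinj : ∀ i < k, ∀ j < k, w i = w j → i = j) :
    ∃ g < L ^ (k * k) * 2 ^ (k * 2 ^ (k * k)), ∀ i < k, col L k (k * k) g 0 (w i) = i := by
  classical
  -- One separating position for each ordered pair of indices, with a dummy for trivial pairs, so
  -- that the list has exactly `k * k` entries.
  have hbit : ∀ q : ℕ × ℕ, ∃ b < L, q.1 < k → q.2 < k → q.1 ≠ q.2 →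
      (w q.1 >>> b) % 2 ≠ (w q.2 >>> b) % 2 := by
    intro q
    by_cases hq : q.1 < k ∧ q.2 < k ∧ q.1 ≠ q.2
    · obtain ⟨b, hb, hne⟩ := exists_bit_ne (fun h => hq.2.2 (hinj _ hq.1 _ hq.2.1 h))
        (hw _ hq.1) (hw _ hq.2.1)
      exact ⟨b, hb, fun _ _ _ => hne⟩
    · exact ⟨0, hL, fun h1 h2 h3 => absurd ⟨h1, h2, h3⟩ hq⟩
  choose β hβ hne using hbit
  set l := (List.range k ×ˢ List.range k).map β with hl
  have hlen : l.length = k * k := by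
    rw [hl, List.length_map]
    exact (List.length_product _ _).trans (by simp)
  have hpat : ∀ i < k, ∀ j < k, pattern l 0 (w i) = pattern l 0 (w j) → i = j := by
    intro i hi j hj h
    by_contra hij
    refine hne (i, j) hi hj hij ((pattern_inj l h).2 _ ?_)
    exact List.mem_map.2 ⟨(i, j), by simp [hi, hj], rfl⟩
  obtain ⟨g, hg, hcol⟩ := exists_digits L k l (by
    intro b hb
    obtain ⟨q, -, rfl⟩ := List.mem_map.1 hb
    exact hβ q)
  -- The table maps the pattern of `w i` back to `i`, and other patterns to `0`. An index fits into
  -- a `k`-bit entry because `i < k < 2 ^ k`.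
  obtain ⟨g', hg', htab⟩ := exists_table k (2 ^ (k * k))
    (fun t => if h : ∃ i < k, pattern l 0 (w i) = t then h.choose else 0) (by
      intro t
      split
      · next h => exact h.choose_spec.1.trans Nat.lt_two_pow_self
      · positivity)
  rw [hlen] at hg hcol
  refine ⟨g + L ^ (k * k) * g', ?_, fun i hi => ?_⟩
  · have : L ^ (k * k) * (g' + 1) ≤ L ^ (k * k) * 2 ^ (k * 2 ^ (k * k)) :=
      Nat.mul_le_mul_left _ hg'
    rw [mul_add] at this
    omega
  · have hlt := pattern_lt l 0 (w i)
    rw [hlen, zero_add, mul_one] at hlt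
    have hex : ∃ j < k, pattern l 0 (w j) = pattern l 0 (w i) := ⟨i, hi, rfl⟩
    rw [hcol, htab _ hlt, dif_pos hex]
    exact hpat _ hex.choose_spec.1 _ hi hex.choose_spec.2

end WordRAM

/-! ### The parameters of a graph -/

namespace DigraphInput

open WordRAM

variable (x : DigraphInput)

/-- The parameters of the reduction for cycles of length `k`. -/
def params (k : ℕ) : Params := ⟨x.n, x.m, k, k * k, fun i => x.encode.getD i 0⟩

theorem getElem?_flatMap_pair {α : Type} (f g : α → ℕ) (l : List α) (e : ℕ) :
    (l.flatMap fun a => [f a, g a])[2 * e]? = l[e]?.map f ∧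
      (l.flatMap fun a => [f a, g a])[2 * e + 1]? = l[e]?.map g := by
  induction l generalizing e with
  | nil => simp
  | cons a l ih =>
    cases e with
    | zero => simp
    | succ e => simpa [mul_add] using ih e

theorem length_encode : x.encode.length = 2 * x.m + 2 := by
  simp [encode, m, List.length_flatMap, mul_comm]

variable {x}

theorem enc_tail {k e : ℕ} (h : e < x.edges.length) :
    (x.params k).enc (2 + 2 * e) = x.edges[e].1.val := by
  have := (getElem?_flatMap_pair (fun e : Fin x.n × Fin x.n => e.1.val) (fun e => e.2.val)
    x.edges e).1
  simp only [params, encode, List.getD_eq_getElem?_getD]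
  rw [List.getElem?_append_right (by simp)]
  simp [this, h]

theorem enc_head {k e : ℕ} (h : e < x.edges.length) :
    (x.params k).enc (3 + 2 * e) = x.edges[e].2.val := by
  have := (getElem?_flatMap_pair (fun e : Fin x.n × Fin x.n => e.1.val) (fun e => e.2.val)
    x.edges e).2
  simp only [params, encode, List.getD_eq_getElem?_getD]
  rw [List.getElem?_append_right (by simp; omega)]
  have h3 : 3 + 2 * e - [x.n, x.m].length = 2 * e + 1 := by simp; omega
  rw [h3, this]
  simp [h]

theorem valid_params {k : ℕ} (hk : 1 ≤ k) : (x.params k).Valid where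
  zero := rfl
  one := rfl
  lt := by
    intro a h2 ha
    change a < 2 * x.m + 2 at ha
    rcases Nat.even_or_odd' a with ⟨c, rfl | rfl⟩
    · obtain ⟨e, rfl⟩ : ∃ e, c = 1 + e := ⟨c - 1, by omega⟩
      have he : e < x.edges.length := by change e < x.m; omega
      rw [mul_add, mul_one, enc_tail he]
      exact Fin.isLt _
    · obtain ⟨e, rfl⟩ : ∃ e, c = 1 + e := ⟨c - 1, by omega⟩
      have he : e < x.edges.length := by change e < x.m; omega
      rw [show 2 * (1 + e) + 1 = 3 + 2 * e by ring, enc_head he]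
      exact Fin.isLt _
  out := by
    intro a ha
    have : x.encode.length ≤ a := by rw [length_encode]; exact ha
    simp [params, List.getD_eq_getElem?_getD, this]
  k_pos := hk

/-- Reading the input at the new name of an occurring vertex gives the vertex back, so the renaming
is injective on such vertices. -/
theorem enc_idOf {p : Params} {a : ℕ} (h2 : 2 ≤ a) (ha : a < p.N) :
    p.enc (p.idOf (p.enc a)) = p.enc a :=
  (Nat.findGreatest_spec (P := fun b => 2 ≤ b ∧ p.enc b = p.enc a) (n := 2 * p.m + 1)
    (by simp only [Params.N] at ha; omega) ⟨h2, rfl⟩).2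

theorem enc_tail_eq {k e : ℕ} (h : e < x.edges.length) :
    (x.params k).enc ((x.params k).tail e) = x.edges[e].1.val := by
  rw [Params.tail, enc_idOf (by omega) ?_, enc_tail h]
  change 2 + 2 * e < 2 * x.m + 2
  change e < x.m at h
  omega

theorem enc_head_eq {k e : ℕ} (h : e < x.edges.length) :
    (x.params k).enc ((x.params k).head e) = x.edges[e].2.val := by
  rw [Params.head, enc_idOf (by omega) ?_, enc_head h]
  change 3 + 2 * e < 2 * x.m + 2
  change e < x.m at h
  omega

theorem simple_params (k : ℕ) : (x.params k).Simple := by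
  intro e he e' he' ht hh
  have he : e < x.edges.length := he
  have he' : e' < x.edges.length := he'
  have h1 := congrArg (x.params k).enc ht
  have h2 := congrArg (x.params k).enc hh
  rw [enc_tail_eq he, enc_tail_eq he'] at h1
  rw [enc_head_eq he, enc_head_eq he'] at h2
  exact (x.nodup.getElem_inj_iff).1 (Prod.ext (Fin.ext h1) (Fin.ext h2))

theorem walkTo_iff {p : Params} {i a b : ℕ} : p.WalkTo i a b ↔
    ∃ c : ℕ → ℕ, c 0 = a ∧ c i = b ∧ ∀ j < i, p.EdgeAt j (c j) (c (j + 1)) := by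
  induction i generalizing b with
  | zero =>
    constructor
    · rintro rfl
      exact ⟨fun _ => a, rfl, rfl, by simp⟩
    · rintro ⟨c, rfl, rfl, -⟩
      rfl
  | succ i ih =>
    constructor
    · rintro ⟨d, hd, he⟩
      obtain ⟨c, h0, hi, hc⟩ := ih.1 hd
      refine ⟨Function.update c (i + 1) b, ?_, by simp, fun j hj => ?_⟩
      · rw [Function.update_of_ne (by omega), h0]
      · rw [Function.update_of_ne (by omega)]
        rcases Nat.lt_succ_iff_lt_or_eq.1 hj with hj | rfl
        · rw [Function.update_of_ne (by omega)]
          exact hc j hj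
        · rw [Function.update_self, hi]
          exact he
    · rintro ⟨c, rfl, rfl, hc⟩
      exact ⟨c i, ih.2 ⟨c, rfl, rfl, fun j hj => hc j (by omega)⟩, hc i (by omega)⟩

theorem ok_eq_one {p : Params} {i g u v : ℕ} : p.ok i g u v = 1 ↔
    col p.L p.k p.K g 0 u = i ∧ col p.L p.k p.K g 0 v = (i + 1) % p.k := by
  simp only [Params.ok]
  split <;> split <;> simp [*]

theorem val_add_one {k : ℕ} [NeZero k] (i : ZMod k) : (i + 1).val = (i.val + 1) % k := by
  rw [ZMod.val_add, ZMod.val_one_eq_one_mod, Nat.add_mod_mod]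

/-- The slots of the walk stay within one colouring, under which the `i`-th address has colour `i`.
Equal vertices have equal addresses, hence equal colours, hence equal indices. -/
theorem hasCycle_of_walkTo {k : ℕ} (hk : 1 ≤ k) {a : ℕ} (h : (x.params k).WalkTo k a a) :
    x.G.HasCycle k := by
  have : NeZero k := ⟨by omega⟩
  obtain ⟨c, h0, hck, hc⟩ := walkTo_iff.1 h
  set p := x.params k with hp
  choose! τ hτ hlayer htail hhead hok using hc
  have hlt : ∀ i < k, p.edge (τ i) < x.edges.length := fun i hi => p.edge_lt (hτ i hi)
  have hN : 0 < p.N := by have := p.N_pos; omega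
  have hmod : ∀ g u, u < p.N → (g * p.N + u) % p.N = u := fun g u h => by
    rw [mul_comm, Nat.mul_add_mod, Nat.mod_eq_of_lt h]
  have hu : ∀ i < k, c i % p.N = p.tail (p.edge (τ i)) := fun i hi => by
    rw [← htail i hi, Params.tailSlot]
    exact hmod _ _ (p.idOf_lt _)
  have hu' : ∀ i < k, c (i + 1) % p.N = p.head (p.edge (τ i)) := fun i hi => by
    rw [← hhead i hi, Params.headSlot]
    exact hmod _ _ (p.idOf_lt _)
  have hdiv : ∀ g u, u < p.N → (g * p.N + u) / p.N = g := fun g u h => by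
    rw [mul_comm, Nat.mul_add_div hN, Nat.div_eq_of_lt h, add_zero]
  have hg : ∀ i < k, c i / p.N = p.colouring (τ i) := fun i hi => by
    rw [← htail i hi, Params.tailSlot]
    exact hdiv _ _ (p.idOf_lt _)
  have hg' : ∀ i < k, c (i + 1) / p.N = p.colouring (τ i) := fun i hi => by
    rw [← hhead i hi, Params.headSlot]
    exact hdiv _ _ (p.idOf_lt _)
  -- The colouring is the quotient of the slot by `N`, and consecutive edges share a slot.
  have hconst : ∀ i < k, p.colouring (τ i) = c 0 / p.N := by
    intro i
    induction i with
    | zero => intro hi; exact (hg 0 hi).symm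
    | succ i ih =>
      intro hi
      rw [← hg _ hi, hg' i (by omega), ih (by omega)]
  have hcol : ∀ i < k, col p.L p.k p.K (c 0 / p.N) 0 (c i % p.N) = i := fun i hi => by
    have := (ok_eq_one.1 (hok i hi)).1
    rwa [hconst i hi, ← hu i hi, hlayer i hi] at this
  have hV : ∀ i (hi : i < k), p.enc (c i % p.N) = (x.edges[p.edge (τ i)]'(hlt i hi)).1.val :=
    fun i hi => by rw [hu i hi, enc_tail_eq (hlt i hi)]
  have hV' : ∀ i (hi : i < k), p.enc (c (i + 1) % p.N) =
      (x.edges[p.edge (τ i)]'(hlt i hi)).2.val :=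
    fun i hi => by rw [hu' i hi, enc_head_eq (hlt i hi)]
  refine ⟨fun i => (x.edges[p.edge (τ i.val)]'(hlt _ i.val_lt)).1, fun i j hij => ?_, fun i => ?_⟩
  · have hij := congrArg Fin.val hij
    simp only [← hV _ i.val_lt, ← hV _ j.val_lt] at hij
    have hid : ∀ i < k, c i % p.N = p.idOf (p.enc (c i % p.N)) := fun i hi => by
      have : 2 + 2 * p.edge (τ i) < p.N := by
        have := hlt i hi
        change 2 + 2 * p.edge (τ i) < 2 * x.m + 2
        change _ < x.m at this
        omega
      rw [hu i hi, Params.tail, enc_idOf (by omega) this]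
    have huv : c i.val % p.N = c j.val % p.N := by
      rw [hid _ i.val_lt, hij, ← hid _ j.val_lt]
    have h1 := hcol _ i.val_lt
    rw [huv, hcol _ j.val_lt] at h1
    exact ZMod.val_injective k h1.symm
  · have hnext : (x.edges[p.edge (τ (i + 1).val)]'(hlt _ (i + 1).val_lt)).1 =
        (x.edges[p.edge (τ i.val)]'(hlt _ i.val_lt)).2 := by
      apply Fin.ext
      rw [← hV _ (i + 1).val_lt, ← hV' _ i.val_lt, val_add_one]
      -- At the last index the successor wraps around to `0`; there the walk closes because `c 0`
      -- and `c k` are the same slot.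
      rcases Nat.lt_or_ge (i.val + 1) k with hi | hi
      · rw [Nat.mod_eq_of_lt hi]
      · have : i.val + 1 = k := le_antisymm i.val_lt hi
        rw [this, Nat.mod_self, h0, hck]
    simp only
    rw [hnext, ← x.mem_edges]
    exact List.getElem_mem _

/-- The vertices of the cycle have distinct addresses, so some colouring gives them the colours `0,
…, k - 1` in order; the walk follows the cycle in that colouring. -/
theorem walkTo_of_hasCycle {k : ℕ} (hk : 1 ≤ k) (h : x.G.HasCycle k) :
    ∃ a < (x.params k).Z, (x.params k).WalkTo k a a := by
  have : NeZero k := ⟨by omega⟩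
  obtain ⟨v, hinj, hadj⟩ := h
  set p := x.params k with hp
  have hedge : ∀ i : ZMod k, ∃ e, ∃ h : e < x.edges.length, x.edges[e] = (v i, v (i + 1)) :=
    fun i => List.getElem_of_mem ((x.mem_edges _ _).2 (hadj i))
  choose ed hed hed' using hedge
  set w : ℕ → ℕ := fun i => p.idOf (v (i : ZMod k)).val with hw
  have htail : ∀ i : ℕ, p.tail (ed i) = w i := fun i => by
    rw [Params.tail, enc_tail (hed i), hed']
  have hhead : ∀ i : ℕ, p.head (ed i) = w (i + 1) := fun i => by
    rw [Params.head, enc_head (hed i), hed']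
    simp [hw]
  have hwk : ∀ i, w (i % k) = w i := fun i => by simp [hw]
  have hencw : ∀ i : ℕ, p.enc (w i) = (v (i : ZMod k)).val := fun i => by
    rw [← htail, enc_tail_eq (hed i), hed']
  obtain ⟨g, hg, hcol⟩ := exists_colouring (L := p.L) (k := k) p.L_pos w
    (fun i _ => by
      refine (p.idOf_lt _).trans_le ?_
      have : 2 * p.m + 1 < 2 ^ p.L := Nat.lt_pow_succ_log_self (by omega) _
      simp only [Params.N]
      omega)
    (fun i hi j hj hij => by
      have h1 : (v (i : ZMod k)).val = (v (j : ZMod k)).val := by rw [← hencw, hij, hencw]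
      have h2 := congrArg ZMod.val (hinj (Fin.ext h1))
      rwa [ZMod.val_natCast_of_lt hi, ZMod.val_natCast_of_lt hj] at h2)
  have hg : g < p.G := hg
  refine ⟨g * p.N + w 0, p.slot_lt hg (p.idOf_lt _), walkTo_iff.2
    ⟨fun i => g * p.N + w i, rfl, ?_, fun i hi => ?_⟩⟩
  · simp only
    rw [← hwk k, Nat.mod_self]
  have hem : ed i < p.m := hed i
  have hpk : p.k = k := rfl
  -- The index of the triple of layer `i`, edge `ed i` and colouring `g` is read off from
  -- `Params.index_eq`.
  have hdivk : (i + k * (ed i + p.m * g)) / k = ed i + p.m * g := by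
    rw [Nat.add_mul_div_left _ _ (by omega), Nat.div_eq_of_lt hi, zero_add]
  have h1 : p.layer (i + k * (ed i + p.m * g)) = i := by
    rw [Params.layer, hpk, Nat.add_mul_mod_self_left, Nat.mod_eq_of_lt hi]
  have h2 : p.edge (i + k * (ed i + p.m * g)) = ed i := by
    rw [Params.edge, hpk, hdivk, Nat.add_mul_mod_self_left, Nat.mod_eq_of_lt hem]
  have h3 : p.colouring (i + k * (ed i + p.m * g)) = g := by
    rw [Params.colouring, hpk, ← Nat.div_div_eq_div_mul, hdivk,
      Nat.add_mul_div_left _ _ (by omega), Nat.div_eq_of_lt hem, zero_add]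
  refine ⟨i + k * (ed i + p.m * g), ?_, h1, ?_, ?_, ?_⟩
  · have h4 : ed i + p.m * g < p.m * p.G := by
      have : p.m * (g + 1) ≤ p.m * p.G := Nat.mul_le_mul_left _ hg
      rw [mul_add] at this
      omega
    have h5 : k * (ed i + p.m * g + 1) ≤ k * (p.m * p.G) := Nat.mul_le_mul_left _ h4
    have h6 : p.R = k * (p.m * p.G) := by rw [Params.R, hpk]; ring
    rw [mul_add, mul_one] at h5
    omega
  · rw [Params.tailSlot, h2, h3, htail]
  · rw [Params.headSlot, h2, h3, hhead]
  · rw [Params.okAt, h1, h2, h3, ok_eq_one, htail, hhead]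
    refine ⟨hcol i hi, ?_⟩
    rw [← hwk, hpk]
    exact hcol _ (Nat.mod_lt _ (by omega))

/-- The coverability instance is equivalent to the existence of a cycle. -/
theorem covers_iff {k : ℕ} (hk : 1 ≤ k) :
    (Params.coverInput (valid_params hk) (simple_params k)).V.Covers
      (Params.coverInput (valid_params hk) (simple_params (x := x) k)).source
      (Params.coverInput (valid_params hk) (simple_params k)).target ↔ x.G.HasCycle k := by
  rw [Params.covers_coverInput]
  exact ⟨fun ⟨a, _, h⟩ => hasCycle_of_walkTo hk h, walkTo_of_hasCycle hk⟩

end DigraphInput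

/-! ### Bounds -/

namespace WordRAM

namespace Params

variable {p : Params}

/-- Crude estimates suffice: what matters is that the exponent does not depend on the graph, so that
all values of the reduction fit into `O(log (n + m))` bits. -/
theorem bound_le {Θ : ℕ} (h2 : 2 ≤ Θ) (hn : p.n < Θ) (hm : p.m < Θ) :
    p.bound ≤ Θ ^ (2 * p.K + p.k * 2 ^ p.K + p.k + 8) := by
  obtain ⟨M, hM⟩ : ∃ M, M = 2 * p.K + p.k * 2 ^ p.K + p.k + 4 := ⟨_, rfl⟩
  have hmono : ∀ a b, a ≤ b → Θ ^ a ≤ Θ ^ b := fun a b h => Nat.pow_le_pow_right (by omega) h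
  have hN : p.N ≤ Θ ^ 2 := by
    simp only [N]
    nlinarith
  have hG : p.G ≤ Θ ^ (2 * p.K + p.k * 2 ^ p.K) := by
    rw [G, pow_add, pow_mul Θ 2, pow_mul Θ p.k]
    exact Nat.mul_le_mul (Nat.pow_le_pow_left (p.L_le_N.trans hN) _) ((pow_mul 2 p.k _).trans_le
      (Nat.pow_le_pow_left (Nat.pow_le_pow_left h2 _) _))
  have hZ : p.Z ≤ Θ ^ (2 * p.K + p.k * 2 ^ p.K + 2) := by
    rw [Z, pow_add]
    exact Nat.mul_le_mul hG hN
  have hk : p.k + 1 ≤ Θ ^ (p.k + 1) :=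
    Nat.lt_two_pow_self.le.trans (Nat.pow_le_pow_left h2 _)
  have hkZ : (p.k + 1) * p.Z ≤ Θ ^ M :=
    (Nat.mul_le_mul hk hZ).trans (by rw [← pow_add]; exact hmono _ _ (by omega))
  have hmN : p.m ≤ p.N := by simp only [N]; omega
  have hR : p.R ≤ Θ ^ M := by
    refine le_trans ?_ hkZ
    rw [R, Z, mul_assoc]
    exact Nat.mul_le_mul (by omega) (Nat.mul_le_mul_left _ hmN)
  have hZ' : p.Z ≤ Θ ^ M := hZ.trans (hmono _ _ (by omega))
  have hN' : p.N ≤ Θ ^ M := hN.trans (hmono _ _ (by omega))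
  have hn' : p.n ≤ Θ ^ M := (by simpa using hn.le : p.n ≤ Θ ^ 1).trans (hmono _ _ (by omega))
  have h8 : 8 ≤ Θ ^ M := (Nat.pow_le_pow_left h2 3).trans (hmono _ _ (by omega))
  have h16 : 16 ≤ Θ ^ 4 := Nat.pow_le_pow_left h2 4
  have hfin : 16 * Θ ^ M ≤ Θ ^ (M + 4) := by
    rw [pow_add, mul_comm]
    exact Nat.mul_le_mul_left _ h16
  have hMe : 2 * p.K + p.k * 2 ^ p.K + p.k + 8 = M + 4 := by omega
  rw [hMe]
  refine le_trans ?_ hfin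
  simp only [bound]
  omega

theorem size_le_bound (hp : p.Valid) (hs : p.Simple) : (coverInput hp hs).size ≤ p.bound := by
  rw [size_coverInput]
  simp only [bound]
  omega

theorem two_le_bound : 2 ≤ p.bound := by
  simp only [bound]
  omega

theorem time_le : p.Z + p.R ≤ (p.k + 2) * (p.G * (p.m + 1)) := by
  simp only [Z, R, N]
  nlinarith [Nat.zero_le (p.k * p.G)]

theorem size_le (hp : p.Valid) (hs : p.Simple) :
    (coverInput hp hs).size ≤ (3 * p.k + 10) * (p.G * (p.m + 1)) := by
  rw [size_coverInput]
  have h2 : p.Z = 2 * (p.G * (p.m + 1)) := by simp only [Z, N]; ring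
  have h3 : p.R ≤ p.k * (p.G * (p.m + 1)) := by
    simp only [R]
    nlinarith [Nat.zero_le (p.k * p.G)]
  generalize p.G * (p.m + 1) = A at *
  have h4 : (p.k + 1) * p.Z = 2 * (p.k * A) + 2 * A := by rw [h2]; ring
  have h5 : (3 * p.k + 10) * A = 3 * (p.k * A) + 10 * A := by ring
  rw [h4, h5]
  omega

theorem size_pos (hp : p.Valid) (hs : p.Simple) : 1 ≤ (coverInput hp hs).size := by
  rw [size_coverInput]
  have := p.two_le_Z
  omega

/-- There are few colourings. -/
theorem exists_G_le (k K : ℕ) {δ : ℝ} (hδ : 0 < δ) : ∃ D : ℝ, 0 < D ∧ ∀ p : Params, p.k = k →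
    p.K = K → ((p.G * (p.m + 1) : ℕ) : ℝ) ≤ D * ((p.m : ℝ) + 1) ^ (1 + δ) := by
  -- The number of bits is at most a constant times `y ^ η`; its `K`-th power then costs only `η * K
  -- ≤ δ` in the exponent. The `+ 1` covers `K = 0`.
  set η : ℝ := δ / (K + 1) with hη
  have hη0 : 0 < η := by positivity
  have hlog2 : 0 < Real.log 2 := Real.log_pos (by norm_num)
  set c : ℝ := 4 ^ η / (η * Real.log 2) with hc
  have hc0 : 0 < c := by positivity
  refine ⟨c ^ K * 2 ^ (k * 2 ^ K), by positivity, ?_⟩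
  rintro p rfl rfl
  have hy : (1 : ℝ) ≤ (p.m : ℝ) + 1 := by
    have : (0 : ℝ) ≤ p.m := Nat.cast_nonneg _
    linarith
  set y : ℝ := (p.m : ℝ) + 1 with hydef
  have hpow : (2 : ℝ) ^ p.L ≤ 4 * y := by
    have h1 : 2 ^ Nat.log 2 (2 * p.m + 1) ≤ 2 * p.m + 1 := Nat.pow_log_le_self 2 (by omega)
    have h2 : 2 ^ p.L ≤ 4 * (p.m + 1) := by rw [L, pow_succ]; omega
    have h3 : ((2 ^ p.L : ℕ) : ℝ) ≤ ((4 * (p.m + 1) : ℕ) : ℝ) := Nat.cast_le.2 h2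
    push_cast at h3
    exact h3
  have hL : (p.L : ℝ) ≤ c * y ^ η := by
    have h1 : (p.L : ℝ) * Real.log 2 ≤ Real.log (4 * y) := by
      rw [← Real.log_pow]
      exact Real.log_le_log (by positivity) hpow
    have h2 : Real.log (4 * y) ≤ (4 * y) ^ η / η := Real.log_le_rpow_div (by positivity) hη0
    rw [Real.mul_rpow (by norm_num) (by linarith)] at h2
    have h3 : c * y ^ η = 4 ^ η * y ^ η / η / Real.log 2 := by
      rw [hc]
      field_simp
    rw [h3, le_div_iff₀ hlog2]
    exact h1.trans h2
  have hLK : (p.L : ℝ) ^ p.K ≤ c ^ p.K * y ^ δ := by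
    calc (p.L : ℝ) ^ p.K ≤ (c * y ^ η) ^ p.K := pow_le_pow_left₀ (Nat.cast_nonneg _) hL _
      _ = c ^ p.K * y ^ (η * p.K) := by
        rw [mul_pow, ← Real.rpow_natCast (y ^ η), ← Real.rpow_mul (by linarith)]
      _ ≤ c ^ p.K * y ^ δ := by
        refine mul_le_mul_of_nonneg_left (Real.rpow_le_rpow_of_exponent_le hy ?_) (by positivity)
        rw [hη, div_mul_eq_mul_div, div_le_iff₀ (by positivity)]
        nlinarith
  have hG : ((p.G * (p.m + 1) : ℕ) : ℝ) = (p.L : ℝ) ^ p.K * 2 ^ (p.k * 2 ^ p.K) * y := by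
    simp only [G]
    push_cast
    ring
  rw [hG, Real.rpow_add (by linarith), Real.rpow_one]
  calc (p.L : ℝ) ^ p.K * 2 ^ (p.k * 2 ^ p.K) * y
      ≤ (c ^ p.K * y ^ δ) * 2 ^ (p.k * 2 ^ p.K) * y := by gcongr
    _ = c ^ p.K * 2 ^ (p.k * 2 ^ p.K) * (y * y ^ δ) := by ring

end Params

/-- The word lengths that occur in the simulation fit into a multiple of the available one. -/
theorem word_bounds {c b W ℓ B size : ℕ} (hℓ : 1 ≤ ℓ) (hB : B ≤ 2 ^ (b * ℓ)) (hsize : size ≤ B) :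
    let w := c * (Nat.log 2 size + 1)
    let w' := (c * (b + 1) + b * W + b + 3) * ℓ
    B ^ W < 2 ^ w' ∧ w ≤ w' ∧ 2 ^ w + B + B < 2 ^ w' := by
  intro w w'
  have hlog : Nat.log 2 size ≤ b * ℓ := by
    calc Nat.log 2 size ≤ Nat.log 2 (2 ^ (b * ℓ)) := Nat.log_mono_right (hsize.trans hB)
      _ = b * ℓ := Nat.log_pow (by omega) _
  have hw : w ≤ c * (b + 1) * ℓ := by
    rw [mul_assoc]
    refine Nat.mul_le_mul_left _ ?_
    rw [add_mul]
    omega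
  have hw' : w' = c * (b + 1) * ℓ + b * ℓ * W + b * ℓ + 3 * ℓ := by ring
  have hp : ∀ i j, i ≤ j → 2 ^ i ≤ 2 ^ j := fun i j h => Nat.pow_le_pow_right (by omega) h
  refine ⟨?_, by omega, ?_⟩
  · calc B ^ W ≤ (2 ^ (b * ℓ)) ^ W := Nat.pow_le_pow_left hB _
      _ = 2 ^ (b * ℓ * W) := by rw [← pow_mul]
      _ < 2 ^ w' := Nat.pow_lt_pow_right (by omega) (by omega)
  · obtain ⟨u, hu⟩ : ∃ u, w' = u + 3 := ⟨w' - 3, by omega⟩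
    have h1 := hp w u (by omega)
    have h2 := hp (b * ℓ) u (by omega)
    have h3 : 0 < 2 ^ u := by positivity
    rw [hu, pow_succ, pow_succ, pow_succ]
    omega

/-- The total running time, for an instance of almost linear size. -/
theorem time_bound {y ε ε₀ D A k k' size u t c C : ℝ} (hy : 1 ≤ y) (hpos : 0 < ε₀)
    (hle : ε₀ ≤ 1 / 2) (hε : ε₀ ≤ ε) (hD : 0 ≤ D) (hk' : 0 ≤ k')
    (hA : A ≤ D * y ^ (1 + ε₀ / 4)) (hsize1 : 1 ≤ size) (hsize : size ≤ k' * A) (hc : 0 ≤ c)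
    (hk : 0 ≤ k) (hu : u ≤ k * A) (ht : t ≤ C * size ^ (2 - ε)) :
    c * u + 2 * t ≤
      (c * (k * D) + 2 * (|C| * (k' * D) ^ (2 - ε₀))) * y ^ (2 - ε₀ / 2) := by
  have hy0 : 0 ≤ y := by linarith
  have hA' : A ≤ D * y ^ (2 - ε₀ / 2) := hA.trans <| mul_le_mul_of_nonneg_left
    (Real.rpow_le_rpow_of_exponent_le hy (by linarith)) hD
  have htime : c * u ≤ c * (k * (D * y ^ (2 - ε₀ / 2))) :=
    mul_le_mul_of_nonneg_left (hu.trans (mul_le_mul_of_nonneg_left hA' hk)) hc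
  have hsize' : size ≤ k' * D * y ^ (1 + ε₀ / 4) := by
    rw [mul_assoc]
    exact hsize.trans (mul_le_mul_of_nonneg_left hA hk')
  have hkD : 0 ≤ k' * D := mul_nonneg hk' hD
  have hpow : size ^ (2 - ε) ≤ (k' * D) ^ (2 - ε₀) * y ^ (2 - ε₀ / 2) := by
    calc size ^ (2 - ε) ≤ size ^ (2 - ε₀) :=
          Real.rpow_le_rpow_of_exponent_le hsize1 (by linarith)
      _ ≤ (k' * D * y ^ (1 + ε₀ / 4)) ^ (2 - ε₀) :=
          Real.rpow_le_rpow (by linarith) hsize' (by linarith)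
      _ = (k' * D) ^ (2 - ε₀) * y ^ ((1 + ε₀ / 4) * (2 - ε₀)) := by
          rw [Real.mul_rpow hkD (Real.rpow_nonneg hy0 _), ← Real.rpow_mul hy0]
      -- The product `(1 + ε₀ / 4) * (2 - ε₀)` equals `2 - ε₀ / 2 - ε₀ ^ 2 / 4`.
      _ ≤ (k' * D) ^ (2 - ε₀) * y ^ (2 - ε₀ / 2) :=
          mul_le_mul_of_nonneg_left (Real.rpow_le_rpow_of_exponent_le hy (by nlinarith))
            (Real.rpow_nonneg hkD _)
  have hrun : t ≤ |C| * ((k' * D) ^ (2 - ε₀) * y ^ (2 - ε₀ / 2)) :=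
    ht.trans <| (mul_le_mul_of_nonneg_right (le_abs_self C)
      (Real.rpow_nonneg (by linarith) _)).trans (mul_le_mul_of_nonneg_left hpow (abs_nonneg C))
  linarith

open DigraphInput in
/-- An algorithm for coverability yields one for cycles of length `k`. -/
theorem decidable_hasCycle {ε : ℝ} (hε : 0 < ε) {k : ℕ} (hk : 1 ≤ k)
    (h : DecidableInTime (UnaryCoverInput.encode (d := 2))
      (fun x => x.V.Covers x.source x.target)
      (fun x => x.size) (fun x => (x.size : ℝ) ^ (2 - ε))) :
    DecidableInTime DigraphInput.encode (fun x => x.G.HasCycle k)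
      (fun x => x.n + x.m) (fun x => ((x.m : ℝ) + 1) ^ (2 - min ε (1 / 2) / 2)) := by
  obtain ⟨P, c, C, hP⟩ := h
  obtain ⟨c1, hred⟩ := Params.wp_reduction k (k * k)
  -- Cutting off at `1 / 2` keeps `2 - ε₀` positive, and `2 - ε₀ / 2` above the exponent `1 + ε₀ /
  -- 4` of the reduction itself.
  set ε₀ := min ε (1 / 2) with hε₀
  have hε₀pos : 0 < ε₀ := lt_min hε (by norm_num)
  have hε₀le : ε₀ ≤ 1 / 2 := min_le_right _ _
  obtain ⟨D, hD, hG⟩ := Params.exists_G_le k (k * k) (δ := ε₀ / 4) (by positivity)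
  set b := 2 * (k * k) + k * 2 ^ (k * k) + k + 8 with hb
  set W := (reduction k (k * k)).weight with hW
  refine ⟨link (reduction k (k * k)) 9 P, c * (b + 1) + b * W + b + 3,
    c1 * ((k + 2) * D) + 2 * (|C| * ((3 * k + 10) * D) ^ (2 - ε₀)), fun x => ?_⟩
  have hv : (x.params k).Valid := valid_params hk
  have hs : (x.params k).Simple := simple_params k
  obtain ⟨t, a, hhalt, hans, ht⟩ := hP (Params.coverInput hv hs)
  set p := x.params k with hp
  set size := (Params.coverInput hv hs).size with hsize
  have hΘ : x.n + x.m < 2 ^ (Nat.log 2 (x.n + x.m) + 1) :=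
    Nat.lt_pow_succ_log_self (by omega) _
  have hB : p.bound ≤ 2 ^ (b * (Nat.log 2 (x.n + x.m) + 1)) := by
    have := p.bound_le (Θ := 2 ^ (Nat.log 2 (x.n + x.m) + 1)) (Nat.le_self_pow (by omega) 2)
      (show x.n < _ by omega) (show x.m < _ by omega)
    rwa [← pow_mul, mul_comm _ (2 * p.K + _ + _ + _)] at this
  obtain ⟨hw1, hw2, hw3⟩ := word_bounds (c := c) (W := W) (by omega) hB
    (Params.size_le_bound hv hs)
  have hbdd : State.Bdd ⟨fun _ => 0, fun i => x.encode.getD i 0⟩ p.bound := by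
    refine ⟨fun _ => Nat.zero_le _, fun i => ?_⟩
    change p.enc i ≤ p.bound
    have hN : p.N = 2 * p.m + 2 := rfl
    simp only [Params.bound]
    rcases Nat.lt_or_ge i p.N with hi | hi
    · rcases Nat.lt_or_ge i 2 with h2 | h2
      · interval_cases i
        · rw [hv.zero]; omega
        · rw [hv.one]; omega
      · have := hv.lt i h2 hi
        omega
    · rw [hv.out i hi]; omega
  have hwp := hred p p.bound rfl rfl hv le_rfl _ hbdd (fun _ => rfl) rfl
  rw [← Params.encode_coverInput hv hs] at hwp
  -- The bound on the guest's values is `2 ^ w + p.bound`: what it computes is below `2 ^ w`, and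
  -- its input cells are at most `p.bound`.
  obtain ⟨t', ht', hhalt'⟩ := haltsIn_link_init Params.two_le_bound hw1 hw2
    (Nat.le_add_right _ p.bound) (Nat.le_add_left _ _) hw3 hwp hhalt
  refine ⟨t', a, hhalt', hans.trans (covers_iff hk), ?_⟩
  have hy : (1 : ℝ) ≤ (x.m : ℝ) + 1 := by
    have : (0 : ℝ) ≤ x.m := Nat.cast_nonneg _
    linarith
  have hA := hG p rfl rfl
  set A : ℝ := ((p.G * (p.m + 1) : ℕ) : ℝ) with hAdef
  change A ≤ D * ((x.m : ℝ) + 1) ^ (1 + ε₀ / 4) at hA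
  have hsize1 : (1 : ℝ) ≤ size := by exact_mod_cast Params.size_pos hv hs
  have hsizeA : (size : ℝ) ≤ (3 * k + 10) * A := by
    have := Params.size_le hv hs
    rw [hAdef]
    exact_mod_cast this
  have htimeA : ((p.Z + p.R : ℕ) : ℝ) ≤ (k + 2) * A := by
    have := p.time_le
    rw [hAdef]
    exact_mod_cast this
  refine (Nat.cast_le.2 ht').trans ?_
  push_cast
  have htime := time_bound hy hε₀pos hε₀le (min_le_left _ _) hD.le (by positivity) hA hsize1 hsizeA
    (Nat.cast_nonneg c1) (k := (k : ℝ) + 2) (by positivity) (by exact_mod_cast htimeA) ht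
  exact_mod_cast htime

end WordRAM

theorem mainTheorem6 (hyp : KCycleHypothesis) (ε : ℝ) (hε : 0 < ε) :
    ¬ WordRAM.DecidableInTime (UnaryCoverInput.encode (d := 2))
      (fun x => x.V.Covers x.source x.target)
      (fun x => x.size) (fun x => (x.size : ℝ) ^ (2 - ε)) := by
  intro h
  obtain ⟨k, hk, hno⟩ := hyp (min ε (1 / 2) / 2) (half_pos (lt_min hε (by norm_num)))
  exact hno (WordRAM.decidable_hasCycle hε hk h)
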